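/- Let $G=(V,E)$ be a finite simple graph with a set of boundary vertices $V_\partial\subseteq V$. To each edge $e$ assign $D_e\in\mathbb N$ and to each half-edge $(e,x)$ (an edge $e$ with an endpoint $x$) the Hilbert space $\mathcal H_{e,x}=\mathbb C^{D_e}$; for $S\subseteq V$ let $\mathcal H_S=\bigotimes_{(e,x):x\in S}\mathcal H_{e,x}$. Let $\phi=|\phi\rangle\langle\phi|$ be a link state, i.e. $|\phi\rangle=\bigotimes_{e\in E}|\phi_e\rangle\in\mathcal H_V$ with $|\phi_e\rangle=\sum_{i=1}^{D_e}\sqrt{\lambda_{e,i}}\,|ii\rangle\in\mathcal H_{e,x}\otimes\mathcal H_{e,y}$ for $e=(xy)$, where $\lambda_{e,i}\ge 0$ and $\sum_i\lambda_{e,i}=1$. Write $\mathcal P_\le(\mathcal H)$ for the positive semidefinite operators on $\mathcal H$ of trace at most $1$. For $\rho,\sigma\in\mathcal P_\le(\mathcal H)$ the purified distance is $P(\rho,\sigma)=\sqrt{1-F_*(\rho,\sigma)^2}$ with $F_*(\rho,\sigma)=\|\sqrt\rho\sqrt\sigma\|_1+\sqrt{(1-\operatorname{tr}\rho)(1-\operatorname{tr}\sigma)}$.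 For $\rho_{AB}\in\mathcal P_\le(\mathcal H_A\otimes\mathcal H_B)$ let $$H_{\min}(A|B)_\rho=\sup_{\sigma\in\mathcal P_\le(\mathcal H_B)}\bigl(-\inf\{t\in\mathbb R:\rho_{AB}\le 2^t\, I_A\otimes\sigma\}\bigr),\qquad H^\varepsilon_{\min}(A|B)_\rho=\sup_{\rho'\in\mathcal P_\le(\mathcal H_A\otimes\mathcal H_B),\ P(\rho',\rho_{AB})\le\varepsilon}H_{\min}(A|B)_{\rho'},$$ with values in $[-\infty,\infty]$; for a state on a larger system the reduced state $\rho_{AB}$ is meant. Let $A\subseteq V_\partial$. A cut for $A$ is a set $\Gamma\subseteq V$ with $\Gamma\cap V_\partial=A$. Let $\Gamma_A$ be a cut for $A$, put $\Gamma_A^c=V\setminus\Gamma_A$, and let $\mathcal C_1(\Gamma_A)$ and $\mathcal C_2(\Gamma_A)$ be the sets of the cuts $\Delta_A$ for $A$ with $\Delta_A\subsetneq\Gamma_A$ and with $\Gamma_A\subsetneq\Delta_A$, respectively. Then for every $\varepsilon\ge 0$ there is a pure subnormalized state $\phi^\varepsilon=|\phi^\varepsilon\rangle\langle\phi^\varepsilon|\in\mathcal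 P_\le(\mathcal H_V)$ (a vector of norm at most $1$, possibly zero) such that $$P(\phi,\phi^\varepsilon)\le 2\left(\sqrt{|\mathcal C_1(\Gamma_A)|}+\sqrt{|\mathcal C_2(\Gamma_A)|}\right)\sqrt\varepsilon,$$ and simultaneously $$H_{\min}(\Gamma_A\setminus\Delta_A\,|\,\Gamma_A^c)_{\phi^\varepsilon}\ge H^\varepsilon_{\min}(\Gamma_A\setminus\Delta_A\,|\,\Gamma_A^c)_{\phi}\quad\text{for all }\Delta_A\in\mathcal C_1(\Gamma_A),$$ $$H_{\min}(\Delta_A\setminus\Gamma_A\,|\,\Gamma_A)_{\phi^\varepsilon}\ge H^\varepsilon_{\min}(\Delta_A\setminus\Gamma_A\,|\,\Gamma_A)_{\phi}\quad\text{for all }\Delta_A\in\mathcal C_2(\Gamma_A).$$ -/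

import Mathlib

open scoped ComplexOrder MatrixOrder Kronecker

namespace LinkStates

noncomputable section

/-! ### States on finite-dimensional systems

A system is given by a finite type `a` labelling its standard orthonormal basis; its operators are
the matrices `Matrix a a ℂ`, with the Loewner order. All logarithms are to base two. -/

section States

variable {a b : Type*} [Fintype a] [DecidableEq a] [Fintype b] [DecidableEq b]

/-- Positive semidefinite operators with trace at most one. -/
def subnormalizedStates (a : Type*) [Fintype a] : Set (Matrix a a ℂ) :=
  {ρ | ρ.PosSemidef ∧ ρ.trace.re ≤ 1}

/-- The operator `|ψ⟩⟨ψ|`. -/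
def pureState (ψ : a → ℂ) : Matrix a a ℂ :=
  Matrix.vecMulVec ψ (star ψ)

/-- The trace norm `‖X‖₁ = tr √(X† X)`. -/
def traceNorm (X : Matrix a a ℂ) : ℝ :=
  (CFC.sqrt (X.conjTranspose * X)).trace.re

/-- The fidelity `F(ρ, σ) = ‖√ρ √σ‖₁`. -/
def fidelity (ρ σ : Matrix a a ℂ) : ℝ :=
  traceNorm (CFC.sqrt ρ * CFC.sqrt σ)

/-- The generalized fidelity `F_*(ρ, σ)` of subnormalized states. -/
def generalizedFidelity (ρ σ : Matrix a a ℂ) : ℝ :=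
  fidelity ρ σ + √((1 - ρ.trace.re) * (1 - σ.trace.re))

/-- The purified distance of subnormalized states. -/
def purifiedDistance (ρ σ : Matrix a a ℂ) : ℝ :=
  √(1 - generalizedFidelity ρ σ ^ 2)

/-- The conditional min-entropy `H_min(A|B)_{ρ|σ} = - inf {t : ρ_AB ≤ 2^t I_A ⊗ σ_B}`, with
`inf ∅ = ∞`. -/
def condMinEntropyRel (ρ : Matrix (a × b) (a × b) ℂ) (σ : Matrix b b ℂ) : EReal :=
  -(⨅ (t : ℝ) (_ : ρ ≤ ((2 : ℝ) ^ t) • ((1 : Matrix a a ℂ) ⊗ₖ σ)), (t : EReal))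

/-- The conditional min-entropy `H_min(A|B)_ρ`. -/
def condMinEntropy (ρ : Matrix (a × b) (a × b) ℂ) : EReal :=
  ⨆ σ ∈ subnormalizedStates b, condMinEntropyRel ρ σ

/-- The smooth conditional min-entropy `H_min^ε(A|B)_ρ`. -/
def smoothCondMinEntropy (ε : ℝ) (ρ : Matrix (a × b) (a × b) ℂ) : EReal :=
  ⨆ ρ' ∈ subnormalizedStates (a × b), ⨆ (_ : purifiedDistance ρ' ρ ≤ ε), condMinEntropy ρ'

end States

/-! ### Link states on a graph -/

section Graph

variable {V : Type*} [Fintype V] [DecidableEq V] (G : SimpleGraph V) [DecidableRel G.Adj]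

/-- The half-edges `(e, x)`: an edge `e` together with an endpoint `x` of `e`. -/
abbrev HalfEdge : Type _ := Σ e : G.edgeSet, {x : V // x ∈ (e : Sym2 V)}

variable {G} (D : G.edgeSet → ℕ)

/-- The standard product basis of `H_V`, the tensor product of `H_{e,x} = ℂ^{D_e}` over all
half-edges. -/
abbrev Config : Type _ := (h : HalfEdge G) → Fin (D h.1)

/-- The standard product basis of `H_S`, the tensor product of `H_{e,x}` over all half-edges
`(e, x)` with `x ∈ S`. -/
abbrev SubConfig (S : Finset V) : Type _ :=
  (h : {h : HalfEdge G // h.2.1 ∈ S}) → Fin (D h.1.1)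

variable {D}

/-- Basis elements of `H_S`, of `H_T` and of the rest combine to a basis element of `H_V`. -/
def join (S T : Finset V) (s : SubConfig D S) (t : SubConfig D T) (r : SubConfig D (S ∪ T)ᶜ) :
    Config D := fun h =>
  if hS : h.2.1 ∈ S then s ⟨h, hS⟩
  else if hT : h.2.1 ∈ T then t ⟨h, hT⟩
  else r ⟨h, by simp [hS, hT]⟩

/-- For disjoint `S` and `T`: the reduced state of `ρ` on the bipartite system `H_S ⊗ H_T`, the
partial trace over all the other half-edges. -/
def reducedState (ρ : Matrix (Config D) (Config D) ℂ) (S T : Finset V) :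
    Matrix (SubConfig D S × SubConfig D T) (SubConfig D S × SubConfig D T) ℂ :=
  fun p q => ∑ r : SubConfig D (S ∪ T)ᶜ, ρ (join S T p.1 p.2 r) (join S T q.1 q.2 r)

/-- The vector `|φ_e⟩ = ∑ i, √(λ i) |i i⟩` of `H_e`, whose basis elements assign a label to each
endpoint of `e`. -/
def edgeVector (e : G.edgeSet) (lam : Fin (D e) → ℝ) :
    ({x : V // x ∈ (e : Sym2 V)} → Fin (D e)) → ℂ :=
  ∑ i : Fin (D e), ((√(lam i) : ℝ) : ℂ) • Pi.single (fun _ => i) (1 : ℂ)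

/-- The tensor product `|φ⟩` of the vectors `|φ_e⟩` over all edges. -/
def linkVector (lam : (e : G.edgeSet) → Fin (D e) → ℝ) : Config D → ℂ :=
  fun c => ∏ e : G.edgeSet, edgeVector e (lam e) (fun x => c ⟨e, x⟩)

/-- The link state `φ = |φ⟩⟨φ|` with Schmidt coefficients `√(λ_{e,i})`. -/
def linkState (lam : (e : G.edgeSet) → Fin (D e) → ℝ) : Matrix (Config D) (Config D) ℂ :=
  pureState (linkVector lam)

/-- The cuts for `A`: vertex sets which meet the boundary exactly in `A`. -/
def cuts (bdry A : Finset V) : Finset (Finset V) :=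
  Finset.univ.filter fun Γ => Γ ∩ bdry = A

/-- The cuts for `A` strictly contained in `Γ`. -/
def smallerCuts (bdry A Γ : Finset V) : Finset (Finset V) :=
  (cuts bdry A).filter fun Δ => Δ ⊂ Γ

/-- The cuts for `A` strictly containing `Γ`. -/
def largerCuts (bdry A Γ : Finset V) : Finset (Finset V) :=
  (cuts bdry A).filter fun Δ => Γ ⊂ Δ

end Graph

end

end LinkStates

open LinkStates

/-!
A link state is a superposition `∑ x, p x |diag x⟩` over the labels `x` of the edges, and the state
`φ^ε` is obtained from it by multiplying the amplitude at `x` by `∏ Δ, Q Δ x`, with one filter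
`Q Δ`, taking values in `[0, 1]`, for each cut `Δ`.

To find the filter for a bipartition `S`, `T`, let `ρ'` be `ε`-close to the reduced state of `φ`
with `ρ' ≤ 2 ^ t • (1 ⊗ σ)`. Pinching with respect to the labels which the environment records
turns the right-hand side into a diagonal matrix, and the left-hand side dominates a pinched pure
state with amplitudes `v`. The filter `min 1 (|v| / p)` brings the link state below `v`, hence below
the same diagonal matrix, and by the Cauchy-Schwarz inequality its loss `∑ x, p x ^ 2 * (1 - Q x)`
is at most `2 ε`. By compactness, a single filter does this for all attainable `t`.

Such bounds survive the other filters. Those which depend on the labels outside `T` are diagonal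
contractions, which commute with the pinching and leave the diagonal bound intact; those which
depend on the labels in `T` are contractions on `H_T` and are absorbed by `σ`. Every filter for a
cut in `Γ` or around `Γ` is of one of these two kinds for every other one. Finally, the losses add
up, and the purified distance is at most the square root of twice the total loss.
-/

namespace LinkStates

open Matrix

noncomputable section

/-! ### Fidelity of matrices -/

section Matrices

variable {a b : Type*} [Fintype a] [Fintype b]

lemma conjTranspose_mul_mul_mono {M N : Matrix a a ℂ} (h : M ≤ N) (B : Matrix a b ℂ) :
    Bᴴ * M * B ≤ Bᴴ * N * B := by
  rw [Matrix.le_iff, ← Matrix.sub_mul, ← Matrix.mul_sub]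
  exact (Matrix.le_iff.1 h).conjTranspose_mul_mul_same B

lemma mul_mul_conjTranspose_mono {M N : Matrix a a ℂ} (h : M ≤ N) (B : Matrix b a ℂ) :
    B * M * Bᴴ ≤ B * N * Bᴴ := by
  simpa only [conjTranspose_conjTranspose] using conjTranspose_mul_mul_mono h Bᴴ

lemma trace_re_mono {M N : Matrix a a ℂ} (h : M ≤ N) : M.trace.re ≤ N.trace.re := by
  have := (Complex.le_def.1 (Matrix.le_iff.1 h).trace_nonneg).1
  simpa [trace_sub] using this

variable [DecidableEq a]

lemma diagonal_ofReal_mono {ι : Type*} [DecidableEq ι] {d d' : ι → ℝ} (h : ∀ i, d i ≤ d' i) :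
    diagonal (fun i => (d i : ℂ)) ≤ diagonal fun i => (d' i : ℂ) := by
  rw [Matrix.le_iff, diagonal_sub]
  exact PosSemidef.diagonal fun i => by simpa using h i

lemma mul_cfc_inv_sqrt {N : Matrix a a ℂ} (hN : N.PosSemidef) :
    N * cfc (fun x : ℝ => (√x)⁻¹) N = CFC.sqrt N := by
  have hcont (f : ℝ → ℝ) : ContinuousOn f (spectrum ℝ N) := N.finite_real_spectrum.continuousOn f
  have hsa : IsSelfAdjoint N := hN.isHermitian
  rw [CFC.sqrt_eq_real_sqrt N hN.nonneg,
    cfcₙ_eq_cfc (hf0 := Real.sqrt_zero)]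
  nth_rw 1 [← cfc_id' ℝ N]
  rw [← cfc_mul _ _ N (hcont _) (hcont _)]
  refine cfc_congr fun x _ => ?_
  rcases le_or_gt x 0 with hx | _
  · simp [Real.sqrt_eq_zero_of_nonpos hx]
  · simpa only [div_eq_mul_inv] using Real.div_sqrt

variable [DecidableEq b]

/- With `N = Zᴴ Z`, the square root of `Z Zᴴ` is `Z N^(-1/2) Zᴴ`, where `N^(-1/2)` is the inverse
on the support of `N` and vanishes on its kernel, which is also the kernel of `Z`. -/
lemma trace_sqrt_mul_conjTranspose_self (Z : Matrix b a ℂ) :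
    (CFC.sqrt (Z * Zᴴ)).trace = (CFC.sqrt (Zᴴ * Z)).trace := by
  set N := Zᴴ * Z with hN
  set G := cfc (fun x : ℝ => (√x)⁻¹) N
  have hNpos : N.PosSemidef := posSemidef_conjTranspose_mul_self Z
  have hNG : N * G = CFC.sqrt N := mul_cfc_inv_sqrt hNpos
  have hG : G.PosSemidef := Matrix.nonneg_iff_posSemidef.1 <|
    cfc_nonneg fun x _ => inv_nonneg.2 (Real.sqrt_nonneg x)
  have hsupport : Z * (G * N * G) = Z := by
    have hNP : N * (G * N * G) = N := by
      rw [← Matrix.mul_assoc, ← Matrix.mul_assoc, hNG, Matrix.mul_assoc, hNG,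
        CFC.sqrt_mul_sqrt_self N hNpos.nonneg]
    refine (sub_eq_zero.1 <| conjTranspose_mul_self_eq_zero.1 ?_).symm
    set P := G * N * G
    calc (Z - Z * P)ᴴ * (Z - Z * P) = N - Pᴴ * N - (N * P - Pᴴ * (N * P)) := by
          simp only [hN, conjTranspose_sub, conjTranspose_mul, Matrix.mul_sub, Matrix.sub_mul,
            Matrix.mul_assoc]
      _ = 0 := by rw [hNP, sub_self]
  have hsqrt : CFC.sqrt (Z * Zᴴ) = Z * G * Zᴴ := by
    refine CFC.sqrt_unique ?_ (Matrix.nonneg_iff_posSemidef.2 (hG.mul_mul_conjTranspose_same Z))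
    calc Z * G * Zᴴ * (Z * G * Zᴴ) = Z * (G * N * G) * Zᴴ := by simp only [hN, Matrix.mul_assoc]
      _ = Z * Zᴴ := by rw [hsupport]
  rw [hsqrt, trace_mul_comm, ← Matrix.mul_assoc, hNG]

lemma fidelity_mul_conjTranspose {ρ : Matrix a a ℂ} (hρ : ρ.PosSemidef) (A : Matrix a b ℂ) :
    fidelity ρ (A * Aᴴ) = (CFC.sqrt (Aᴴ * ρ * A)).trace.re := by
  set r := CFC.sqrt ρ
  set s := CFC.sqrt (A * Aᴴ)
  have hr : rᴴ = r := (CFC.sqrt_nonneg ρ).isSelfAdjoint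
  have hs : sᴴ = s := (CFC.sqrt_nonneg (A * Aᴴ)).isSelfAdjoint
  have hrr : r * r = ρ := CFC.sqrt_mul_sqrt_self ρ hρ.nonneg
  have hss : s * s = A * Aᴴ := CFC.sqrt_mul_sqrt_self _
    (Matrix.nonneg_iff_posSemidef.2 (posSemidef_self_mul_conjTranspose A))
  have hZ : r * s * (r * s)ᴴ = r * A * (r * A)ᴴ := by
    simp only [conjTranspose_mul, hr, hs, ← Matrix.mul_assoc]
    rw [Matrix.mul_assoc r s s, hss, ← Matrix.mul_assoc]
  rw [fidelity, traceNorm, ← trace_sqrt_mul_conjTranspose_self, hZ,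
    trace_sqrt_mul_conjTranspose_self, conjTranspose_mul, hr, ← Matrix.mul_assoc,
    Matrix.mul_assoc Aᴴ, hrr]

lemma fidelity_mul_mul_conjTranspose {ρ : Matrix a a ℂ} (hρ : ρ.PosSemidef) {τ : Matrix b b ℂ}
    (hτ : τ.PosSemidef) (V : Matrix a b ℂ) :
    fidelity ρ (V * τ * Vᴴ) = fidelity (Vᴴ * ρ * V) τ := by
  obtain ⟨B, rfl⟩ := CStarAlgebra.nonneg_iff_eq_star_mul_self.1 hτ.nonneg
  have h := fidelity_mul_conjTranspose (hρ.conjTranspose_mul_mul_same V) Bᴴ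
  have h' := fidelity_mul_conjTranspose hρ (V * Bᴴ)
  simp only [conjTranspose_mul, conjTranspose_conjTranspose, Matrix.mul_assoc] at h h'
  simpa only [Matrix.star_eq_conjTranspose, Matrix.mul_assoc, h] using h'

lemma fidelity_nonneg (ρ σ : Matrix a a ℂ) : 0 ≤ fidelity ρ σ :=
  (Complex.le_def.1 (Matrix.nonneg_iff_posSemidef.1 (CFC.sqrt_nonneg _)).trace_nonneg).1

lemma trace_sqrt_re_le {N : Matrix a a ℂ} (hN : N.PosSemidef) :
    (CFC.sqrt N).trace.re ≤ ∑ k, √(N k k).re := by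
  set R := CFC.sqrt N
  have hR : Rᴴ = R := (CFC.sqrt_nonneg N).isSelfAdjoint
  have hRR : Rᴴ * R = N := by
    rw [hR]; exact CFC.sqrt_mul_sqrt_self N hN.nonneg
  rw [trace, Complex.re_sum]
  refine Finset.sum_le_sum fun k _ => Real.le_sqrt_of_sq_le ?_
  have hNk : (N k k).re = ∑ j, ‖R j k‖ ^ 2 := by
    simp [← hRR, Matrix.mul_apply, conjTranspose_apply, Complex.conj_mul', ← Complex.ofReal_pow]
  calc (R k k).re ^ 2 ≤ ‖R k k‖ ^ 2 := sq_le_sq.2 <| by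
        rw [abs_norm]; exact Complex.abs_re_le_norm _
    _ ≤ ∑ j, ‖R j k‖ ^ 2 :=
        Finset.single_le_sum (f := fun j => ‖R j k‖ ^ 2) (fun _ _ => sq_nonneg _)
          (Finset.mem_univ k)
    _ = (N k k).re := hNk.symm

lemma mul_conjTranspose_self_le_one {V : Matrix b a ℂ} (hV : Vᴴ * V = 1) : V * Vᴴ ≤ 1 := by
  have h : 1 - V * Vᴴ = (1 - V * Vᴴ)ᴴ * (1 - V * Vᴴ) := by
    calc 1 - V * Vᴴ = 1 - V * Vᴴ - (V * Vᴴ - V * (Vᴴ * V) * Vᴴ) := by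
          rw [hV, Matrix.mul_one, sub_self, sub_zero]
      _ = _ := by
          simp only [conjTranspose_sub, conjTranspose_one, conjTranspose_mul,
            conjTranspose_conjTranspose, Matrix.sub_mul, Matrix.mul_sub, Matrix.one_mul,
            Matrix.mul_one, Matrix.mul_assoc]
  rw [Matrix.le_iff, h]
  exact posSemidef_conjTranspose_mul_self _

lemma trace_conjTranspose_mul_mul_re_le {V : Matrix b a ℂ} (hV : Vᴴ * V = 1) {M : Matrix b b ℂ}
    (hM : M.PosSemidef) : (Vᴴ * M * V).trace.re ≤ M.trace.re := by
  obtain ⟨B, rfl⟩ := CStarAlgebra.nonneg_iff_eq_star_mul_self.1 hM.nonneg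
  rw [Matrix.star_eq_conjTranspose]
  calc (Vᴴ * (Bᴴ * B) * V).trace.re = (B * (V * Vᴴ) * Bᴴ).trace.re := by
        rw [trace_mul_cycle, trace_mul_cycle B, trace_mul_comm]
    _ ≤ (B * 1 * Bᴴ).trace.re :=
        trace_re_mono (mul_mul_conjTranspose_mono (mul_conjTranspose_self_le_one hV) B)
    _ = (Bᴴ * B).trace.re := by rw [Matrix.mul_one, trace_mul_comm]

end Matrices

section PureState

variable {a b : Type*}

lemma pureState_eq_replicateCol_mul (ψ : a → ℂ) :
    pureState ψ = replicateCol Unit ψ * (replicateCol Unit ψ)ᴴ := by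
  rw [pureState, vecMulVec_eq Unit, conjTranspose_replicateCol]

variable [Fintype a]

lemma posSemidef_pureState (ψ : a → ℂ) : (pureState ψ).PosSemidef :=
  posSemidef_vecMulVec_self_star ψ

lemma trace_pureState (ψ : a → ℂ) : (pureState ψ).trace = ((∑ i, ‖ψ i‖ ^ 2 : ℝ) : ℂ) := by
  simp [pureState, trace_vecMulVec, dotProduct, Complex.mul_conj']

lemma pureState_mem_subnormalizedStates {ψ : a → ℂ} (h : ∑ i, ‖ψ i‖ ^ 2 ≤ 1) :
    pureState ψ ∈ subnormalizedStates a :=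
  ⟨posSemidef_pureState ψ, by rwa [trace_pureState, Complex.ofReal_re]⟩

lemma mul_pureState_mul_conjTranspose (M : Matrix b a ℂ) (ψ : a → ℂ) :
    M * pureState ψ * Mᴴ = pureState (M *ᵥ ψ) := by
  rw [pureState, pureState, mul_vecMulVec, vecMulVec_mul, star_mulVec]

variable [DecidableEq a]

lemma pureState_le_one {ψ : a → ℂ} (hψ : ∑ i, ‖ψ i‖ ^ 2 = 1) : pureState ψ ≤ 1 := by
  rw [pureState_eq_replicateCol_mul]
  refine mul_conjTranspose_self_le_one (Matrix.ext fun _ _ => ?_)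
  simp [Matrix.mul_apply, Complex.conj_mul', ← Complex.ofReal_pow, ← Complex.ofReal_sum, hψ]

lemma fidelity_pureState (φ ψ : a → ℂ) :
    fidelity (pureState φ) (pureState ψ) = ‖star φ ⬝ᵥ ψ‖ := by
  set A := replicateCol Unit ψ
  have hconj : Aᴴ * pureState φ * A = pureState (Aᴴ *ᵥ φ) := by
    simpa only [conjTranspose_conjTranspose] using mul_pureState_mul_conjTranspose Aᴴ φ
  have hentry (i : Unit) : (Aᴴ *ᵥ φ) i = star (star φ ⬝ᵥ ψ) := by
    rw [← star_dotProduct, conjTranspose_replicateCol]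
    rfl
  have hsqrt : CFC.sqrt (Aᴴ * pureState φ * A) = diagonal fun _ => (‖star φ ⬝ᵥ ψ‖ : ℂ) := by
    refine CFC.sqrt_unique (Matrix.ext fun _ _ => ?_) (PosSemidef.diagonal fun _ => by simp).nonneg
    rw [hconj, pureState, vecMulVec_apply, Pi.star_apply, hentry, diagonal_mul_diagonal]
    simp [Complex.conj_mul', sq]
  rw [pureState_eq_replicateCol_mul ψ, fidelity_mul_conjTranspose (posSemidef_pureState φ), hsqrt]
  simp

lemma purifiedDistance_pureState_le {φ ψ : a → ℂ} {δ : ℝ}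
    (hφ : ∑ i, ‖φ i‖ ^ 2 = 1) (h : 1 - δ ≤ ‖star φ ⬝ᵥ ψ‖) :
    purifiedDistance (pureState φ) (pureState ψ) ≤ √(2 * δ) := by
  refine Real.sqrt_le_sqrt ?_
  rw [generalizedFidelity, fidelity_pureState, trace_pureState, hφ, Complex.ofReal_one,
    Complex.one_re, sub_self, zero_mul, Real.sqrt_zero, add_zero]
  nlinarith [sq_nonneg (1 - ‖star φ ⬝ᵥ ψ‖)]

lemma exists_pureState_le {N : Matrix a a ℂ} (hN : N.PosSemidef) (w : a → ℂ) :
    ∃ v, pureState v ≤ N ∧ star w ⬝ᵥ v = (√(star w ⬝ᵥ N *ᵥ w).re : ℝ) := by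
  obtain ⟨B, rfl⟩ := CStarAlgebra.nonneg_iff_eq_star_mul_self.1 hN.nonneg
  rw [Matrix.star_eq_conjTranspose]
  set u := B *ᵥ w with hu
  set s := ∑ i, ‖u i‖ ^ 2 with hs
  have hus : star u ⬝ᵥ u = s := by simp [dotProduct, Complex.conj_mul', hs]
  have hBu (x : a → ℂ) : star w ⬝ᵥ Bᴴ *ᵥ x = star u ⬝ᵥ x := by
    rw [hu, star_mulVec, dotProduct_mulVec]
  rw [← mulVec_mulVec, hBu, hus, Complex.ofReal_re]
  rcases (show 0 ≤ s by positivity).eq_or_lt with h | h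
  · refine ⟨0, ?_, by simp [← h]⟩
    simpa only [pureState, zero_vecMulVec] using (posSemidef_conjTranspose_mul_self B).nonneg
  refine ⟨Bᴴ *ᵥ ((√s)⁻¹ : ℂ) • u, ?_, ?_⟩
  · have hunit : ∑ i, ‖(((√s)⁻¹ : ℂ) • u) i‖ ^ 2 = 1 := by
      simp [mul_pow, ← Finset.mul_sum, ← hs, h.le, h.ne']
    rw [← mul_pureState_mul_conjTranspose, conjTranspose_conjTranspose]
    simpa only [Matrix.mul_one] using conjTranspose_mul_mul_mono (pureState_le_one hunit) B
  · rw [hBu, dotProduct_smul, hus, smul_eq_mul, ← Complex.ofReal_inv, ← Complex.ofReal_mul,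
      ← div_eq_inv_mul, Real.div_sqrt]

end PureState

/-! ### Pinchings -/

section Pinching

variable {C M : Type*} [DecidableEq M]

/-- The pinching of `N`, a block-diagonal part: it keeps the entries of `N` inside the blocks
`{c | μ c = m}` and deletes the others. -/
def pinching (μ : C → M) (N : Matrix C C ℂ) : Matrix C C ℂ :=
  Matrix.of fun c c' => if μ c = μ c' then N c c' else 0

variable {μ : C → M}

lemma pinching_apply_self (N : Matrix C C ℂ) (c : C) : pinching μ N c c = N c c :=
  if_pos rfl

lemma pinching_smul (r : ℝ) (N : Matrix C C ℂ) : pinching μ (r • N) = r • pinching μ N := by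
  ext c c'
  simp [pinching]

lemma trace_pinching [Fintype C] (N : Matrix C C ℂ) : (pinching μ N).trace = N.trace :=
  Finset.sum_congr rfl fun c _ => pinching_apply_self N c

lemma pinching_diagonal_mul_mul [Fintype C] [DecidableEq C] (d d' : C → ℂ) (N : Matrix C C ℂ) :
    pinching μ (diagonal d * N * diagonal d') = diagonal d * pinching μ N * diagonal d' := by
  ext c c'
  simp [pinching]

lemma sum_pinching_pureState_smul {C H M : Type*} [Fintype H] [DecidableEq M] (μ : C → M)
    {p : H → ℝ} (hp : ∑ h, p h ^ 2 = 1) (a : C → ℂ) :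
    ∑ h, pinching μ (pureState fun c => p h * a c) = pinching μ (pureState a) := by
  have hsum : ∑ h, (p h : ℂ) ^ 2 = 1 := by exact_mod_cast hp
  have hentry (c c' : C) (h : H) : p h * a c * star (p h * a c') =
      (p h : ℂ) ^ 2 * (a c * star (a c')) := by
    rw [star_mul', RCLike.star_def, Complex.conj_ofReal]
    ring
  ext c c'
  by_cases h : μ c = μ c' <;>
    simp only [Matrix.sum_apply, pinching, pureState, of_apply, vecMulVec_apply, Pi.star_apply,
      hentry, h, if_true, if_false, ← Finset.sum_mul, hsum, one_mul, Finset.sum_const_zero]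

variable [Fintype M]

/-- The matrix whose columns are the restrictions of `v` to the blocks `{c | μ c = m}`. -/
def blockColumns (μ : C → M) (v : C → ℂ) : Matrix C M ℂ :=
  Matrix.of fun c m => if μ c = m then v c else 0

lemma blockColumns_mul_conjTranspose (v : C → ℂ) :
    blockColumns μ v * (blockColumns μ v)ᴴ = pinching μ (pureState v) := by
  ext c c'
  by_cases h : μ c = μ c' <;>
    simp [blockColumns, pinching, pureState, Matrix.mul_apply, vecMulVec_apply, h, eq_comm]

variable [Fintype C]

lemma posSemidef_pinching_pureState (v : C → ℂ) : (pinching μ (pureState v)).PosSemidef :=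
  blockColumns_mul_conjTranspose (μ := μ) v ▸ posSemidef_self_mul_conjTranspose _

variable [DecidableEq C]

lemma pinching_eq_sum (N : Matrix C C ℂ) :
    pinching μ N = ∑ m, (diagonal fun c => if μ c = m then (1 : ℂ) else 0) * N *
      (diagonal fun c => if μ c = m then (1 : ℂ) else 0)ᴴ := by
  ext c c'
  by_cases h : μ c = μ c' <;>
    simp [pinching, Matrix.sum_apply, Pi.star_apply, apply_ite, h, eq_comm]

lemma pinching_mono {N N' : Matrix C C ℂ} (h : N ≤ N') : pinching μ N ≤ pinching μ N' := by
  rw [pinching_eq_sum, pinching_eq_sum]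
  exact Finset.sum_le_sum fun m _ => mul_mul_conjTranspose_mono h _

lemma exists_fidelity_pinching_le {N : Matrix C C ℂ} (hN : N.PosSemidef) (a : C → ℂ) :
    ∃ v, pinching μ (pureState v) ≤ pinching μ N ∧
      fidelity N (pinching μ (pureState a)) ≤ (star a ⬝ᵥ v).re := by
  set A := blockColumns μ a with hA
  choose v hv hAv using fun m => exists_pureState_le hN (A.col m)
  refine ⟨fun c => v (μ c) c, ?_, ?_⟩
  · have hblock (m : M) :
        (diagonal fun c => if μ c = m then (1 : ℂ) else 0) *ᵥ (fun c => v (μ c) c) =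
          (diagonal fun c => if μ c = m then (1 : ℂ) else 0) *ᵥ v m := by
      ext c
      by_cases h : μ c = m <;> simp [mulVec_diagonal, h]
    rw [pinching_eq_sum, pinching_eq_sum]
    refine Finset.sum_le_sum fun m _ => ?_
    rw [mul_pureState_mul_conjTranspose, hblock, ← mul_pureState_mul_conjTranspose]
    exact mul_mul_conjTranspose_mono (hv m) _
  · have hcol (m : M) : √((Aᴴ * N * A) m m).re = (star (A.col m) ⬝ᵥ v m).re := by
      rw [hAv, Complex.ofReal_re, Matrix.mul_assoc]
      rfl
    rw [← blockColumns_mul_conjTranspose, fidelity_mul_conjTranspose hN]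
    refine (trace_sqrt_re_le (hN.conjTranspose_mul_mul_same A)).trans (le_of_eq ?_)
    simp only [hcol, ← Complex.re_sum, dotProduct]
    rw [Finset.sum_comm]
    simp [hA, blockColumns, Matrix.col_apply, apply_ite]

end Pinching

/-! ### Gentle filters -/

section Filter

variable {ι : Type*} [Fintype ι]

/-- A filter, multiplying the amplitudes `a i` by factors `Q i ∈ [0, 1]`, which is gentle: the
squared amplitudes lose at most `δ`. -/
structure IsGentleFilter (a : ι → ℝ) (δ : ℝ) (Q : ι → ℝ) : Prop where
  nonneg (i : ι) : 0 ≤ Q i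
  le_one (i : ι) : Q i ≤ 1
  loss : ∑ i, a i ^ 2 * (1 - Q i) ≤ δ

variable {a : ι → ℝ} {δ : ℝ}

lemma isGentleFilter_one (hδ : 0 ≤ δ) : IsGentleFilter a δ fun _ => 1 :=
  ⟨fun _ => zero_le_one, fun _ => le_rfl, by simpa using hδ⟩

namespace IsGentleFilter

lemma abs_le_one {Q : ι → ℝ} (hQ : IsGentleFilter a δ Q) (i : ι) : |Q i| ≤ 1 :=
  abs_le.2 ⟨by linarith [hQ.nonneg i], hQ.le_one i⟩

lemma one_sub_le_sum_mul {Q : ι → ℝ} (hQ : IsGentleFilter a δ Q) (ha : ∑ i, a i ^ 2 = 1) :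
    1 - δ ≤ ∑ i, a i * (Q i * a i) := by
  have hsplit : ∑ i, a i ^ 2 * (1 - Q i) = 1 - ∑ i, a i * (Q i * a i) := by
    conv_rhs => rw [← ha, ← Finset.sum_sub_distrib]
    exact Finset.sum_congr rfl fun i _ => by ring
  linarith [hQ.loss]

lemma mul {δ' : ℝ} {Q Q' : ι → ℝ} (hQ : IsGentleFilter a δ Q) (hQ' : IsGentleFilter a δ' Q') :
    IsGentleFilter a (δ + δ') fun i => Q i * Q' i where
  nonneg i := mul_nonneg (hQ.nonneg i) (hQ'.nonneg i)
  le_one i := mul_le_one₀ (hQ.le_one i) (hQ'.nonneg i) (hQ'.le_one i)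
  loss := by
    refine le_trans ?_ (add_le_add hQ.loss hQ'.loss)
    rw [← Finset.sum_add_distrib]
    refine Finset.sum_le_sum fun i _ => ?_
    rw [← mul_add]
    refine mul_le_mul_of_nonneg_left ?_ (sq_nonneg _)
    nlinarith [mul_nonneg (sub_nonneg.2 (hQ.le_one i)) (sub_nonneg.2 (hQ'.le_one i))]

lemma finset_prod {κ : Type*} {Q : κ → ι → ℝ} (hQ : ∀ k, IsGentleFilter a δ (Q k)) (s : Finset κ) :
    IsGentleFilter a (s.card * δ) fun i => ∏ k ∈ s, Q k i := by
  classical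
  induction s using Finset.induction_on with
  | empty => simpa using isGentleFilter_one le_rfl
  | insert k s hk ih =>
    simp only [Finset.prod_insert hk, Finset.card_insert_of_notMem hk, Nat.cast_succ, add_one_mul]
    rw [add_comm]
    exact (hQ k).mul ih

lemma isClosed_setOf (a : ι → ℝ) (δ : ℝ) : IsClosed {Q | IsGentleFilter a δ Q} := by
  have h : {Q | IsGentleFilter a δ Q} =
      (⋂ i, {Q | 0 ≤ Q i}) ∩ (⋂ i, {Q | Q i ≤ 1}) ∩ {Q | ∑ i, a i ^ 2 * (1 - Q i) ≤ δ} := by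
    ext Q
    simp only [Set.mem_inter_iff, Set.mem_iInter]
    exact ⟨fun h => ⟨⟨h.nonneg, h.le_one⟩, h.loss⟩, fun h => ⟨h.1.1, h.1.2, h.2⟩⟩
  rw [h]
  refine ((isClosed_iInter fun i => ?_).inter (isClosed_iInter fun i => ?_)).inter ?_ <;>
    exact isClosed_le (by fun_prop) (by fun_prop)

end IsGentleFilter

lemma sq_mul_one_sub_min_le {x y : ℝ} (hx : 0 ≤ x) :
    x ^ 2 * (1 - min 1 (y / x)) ≤ x * |x - y| := by
  rcases hx.eq_or_lt with rfl | hx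
  · simp
  rw [sq, mul_assoc]
  refine mul_le_mul_of_nonneg_left ?_ hx.le
  rcases le_total 1 (y / x) with h | h
  · rw [min_eq_left h, sub_self, mul_zero]
    exact abs_nonneg _
  · rw [min_eq_right h, mul_sub, mul_one, mul_div_cancel₀ _ hx.ne']
    exact le_abs_self _

lemma isGentleFilter_min_div {b : ι → ℝ} {ε : ℝ} (hε : 0 ≤ ε) (ha : ∀ i, 0 ≤ a i)
    (hb : ∀ i, 0 ≤ b i) (ha1 : ∑ i, a i ^ 2 = 1) (hb1 : ∑ i, b i ^ 2 ≤ 1)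
    (hab : 1 - ε ^ 2 ≤ ∑ i, a i * b i) :
    IsGentleFilter a (2 * ε) fun i => min 1 (b i / a i) where
  nonneg i := le_min zero_le_one (div_nonneg (hb i) (ha i))
  le_one i := min_le_left _ _
  loss := by
    have hdist : ∑ i, |a i - b i| ^ 2 ≤ 2 * ε ^ 2 := by
      have : ∑ i, |a i - b i| ^ 2 = ∑ i, a i ^ 2 + ∑ i, b i ^ 2 - 2 * ∑ i, a i * b i := by
        rw [Finset.mul_sum, ← Finset.sum_add_distrib, ← Finset.sum_sub_distrib]
        exact Finset.sum_congr rfl fun i _ => by rw [sq_abs]; ring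
      linarith
    refine (Finset.sum_le_sum fun i _ => sq_mul_one_sub_min_le (ha i)).trans ?_
    refine abs_le_of_sq_le_sq' ?_ (by positivity) |>.2
    calc (∑ i, a i * |a i - b i|) ^ 2 ≤ (∑ i, a i ^ 2) * ∑ i, |a i - b i| ^ 2 :=
          Finset.sum_mul_sq_le_sq_mul_sq _ _ _
      _ ≤ (2 * ε) ^ 2 := by rw [ha1]; nlinarith [sq_nonneg ε]

end Filter

section Bound

variable {C K M : Type*} [DecidableEq C] [DecidableEq M] [Fintype K]

/-- The factors `Q` and the weights `w` certify the bound `l` on the state with amplitudes `a` on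
the core labels `C`, once these are filtered by `Q`: tracing out the labels `μ` leaves a state which
is at most `l` times the diagonal operator with entries `w (κ c)`. -/
structure IsFilterBound (κ : C → K) (μ : C → M) (a : C → ℝ) (l : ℝ) (Q : C → ℝ) (w : K → ℝ) :
    Prop where
  nonneg (k : K) : 0 ≤ w k
  sum_le_one : ∑ k, w k ≤ 1
  le_diagonal : pinching μ (pureState fun c => ((Q c * a c : ℝ) : ℂ)) ≤
    diagonal fun c => ((l * w (κ c) : ℝ) : ℂ)

variable {κ : C → K} {μ : C → M} {a : C → ℝ} {δ : ℝ}

lemma IsFilterBound.mono {l l' : ℝ} (hl : l ≤ l') {Q : C → ℝ} {w : K → ℝ}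
    (h : IsFilterBound κ μ a l Q w) : IsFilterBound κ μ a l' Q w where
  nonneg := h.nonneg
  sum_le_one := h.sum_le_one
  le_diagonal := h.le_diagonal.trans <| diagonal_ofReal_mono fun c =>
    mul_le_mul_of_nonneg_right hl (h.nonneg (κ c))

variable [Fintype C]

open scoped Matrix.Norms.L2Operator in
lemma IsFilterBound.isClosed_setOf (κ : C → K) (μ : C → M) (a : C → ℝ) (l : ℝ) :
    IsClosed {x : (C → ℝ) × (K → ℝ) | IsFilterBound κ μ a l x.1 x.2} := by
  have h : {x : (C → ℝ) × (K → ℝ) | IsFilterBound κ μ a l x.1 x.2} =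
      (⋂ k, {x | 0 ≤ x.2 k}) ∩ {x | ∑ k, x.2 k ≤ 1} ∩
      {x | pinching μ (pureState fun c => ((x.1 c * a c : ℝ) : ℂ)) ≤
        diagonal fun c => ((l * x.2 (κ c) : ℝ) : ℂ)} := by
    ext x
    simp only [Set.mem_inter_iff, Set.mem_iInter]
    exact ⟨fun h => ⟨⟨h.nonneg, h.sum_le_one⟩, h.le_diagonal⟩, fun h => ⟨h.1.1, h.1.2, h.2⟩⟩
  rw [h]
  refine ((isClosed_iInter fun k => ?_).inter ?_).inter ?_
  · exact isClosed_le (by fun_prop) (by fun_prop)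
  · exact isClosed_le (by fun_prop) (by fun_prop)
  · refine isClosed_le (continuous_matrix fun c c' => ?_) (by fun_prop)
    simp only [pinching, pureState, Matrix.of_apply, vecMulVec_apply, Pi.star_apply]
    split_ifs <;> fun_prop

lemma isCompact_setOf_isGentleFilter_isFilterBound (κ : C → K) (μ : C → M) (a : C → ℝ) (δ l : ℝ) :
    IsCompact {x : (C → ℝ) × (K → ℝ) | IsGentleFilter a δ x.1 ∧ IsFilterBound κ μ a l x.1 x.2} := by
  refine (isCompact_Icc (a := (0 : (C → ℝ) × (K → ℝ))) (b := 1)).of_isClosed_subset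
    (((IsGentleFilter.isClosed_setOf a δ).preimage continuous_fst).inter
      (IsFilterBound.isClosed_setOf κ μ a l)) ?_
  rintro ⟨Q, w⟩ ⟨hQ, hw⟩
  exact ⟨⟨hQ.nonneg, hw.nonneg⟩, hQ.le_one, fun k =>
    (Finset.single_le_sum (fun k _ => hw.nonneg k) (Finset.mem_univ k)).trans hw.sum_le_one⟩

lemma exists_isFilterBound_forall (κ : C → K) (μ : C → M) (a : C → ℝ) (hδ : 0 ≤ δ) :
    ∃ Q w, IsGentleFilter a δ Q ∧
      ∀ l, (∃ Q' w', IsGentleFilter a δ Q' ∧ IsFilterBound κ μ a l Q' w') →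
        IsFilterBound κ μ a l Q w := by
  set A : Set ℝ := {l | ∃ Q' w', IsGentleFilter a δ Q' ∧ IsFilterBound κ μ a l Q' w'}
  rcases isEmpty_or_nonempty A with hA | hA
  · exact ⟨fun _ => 1, 0, isGentleFilter_one hδ, fun l hl => (hA.false ⟨l, hl⟩).elim⟩
  have hcompact (l : ℝ) := isCompact_setOf_isGentleFilter_isFilterBound κ μ a δ l
  obtain ⟨⟨Q, w⟩, hQw⟩ := IsCompact.nonempty_iInter_of_directed_nonempty_isCompact_isClosed
    (fun l : A => {x : (C → ℝ) × (K → ℝ) | IsGentleFilter a δ x.1 ∧ IsFilterBound κ μ a l x.1 x.2})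
    (directed_of_isDirected_ge fun l l' hl x hx => ⟨hx.1, hx.2.mono hl⟩)
    (fun ⟨l, Q', w', h⟩ => ⟨(Q', w'), h⟩) (fun l => hcompact l) (fun l => (hcompact l).isClosed)
  rw [Set.mem_iInter] at hQw
  exact ⟨Q, w, (hQw hA.some).1, fun l hl => (hQw ⟨l, hl⟩).2⟩

end Bound

/-! ### Smoothing the conditional min-entropy -/

section Attach

variable {C K M S T : Type*} [DecidableEq S]

/-- The operator which sends the core label `c` to the product of the basis vector `s c` and of the
column `κ c` of `Φ`. -/
def attach (s : C → S) (κ : C → K) (Φ : Matrix T K ℂ) : Matrix (S × T) C ℂ :=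
  ((1 : Matrix S S ℂ) ⊗ₖ Φ).submatrix id fun c => (s c, κ c)

lemma attach_mul_diagonal [Fintype C] [DecidableEq C] [Fintype K] [DecidableEq K] (s : C → S)
    (κ : C → K) (Φ : Matrix T K ℂ) (d : K → ℂ) :
    attach s κ Φ * diagonal (fun c => d (κ c)) = attach s κ (Φ * diagonal d) := by
  ext p c
  simp [attach, mul_assoc]

variable [Fintype S] [Fintype T] {s : C → S} {κ : C → K}

lemma conjTranspose_attach_mul_kronecker_mul (Φ : Matrix T K ℂ) (σ : Matrix T T ℂ) :
    (attach s κ Φ)ᴴ * ((1 : Matrix S S ℂ) ⊗ₖ σ) * attach s κ Φ =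
      ((1 : Matrix S S ℂ) ⊗ₖ (Φᴴ * σ * Φ)).submatrix (fun c => (s c, κ c)) fun c => (s c, κ c) := by
  have hsub : ((1 : Matrix S S ℂ) ⊗ₖ (Φᴴ * σ * Φ)) =
      ((1 : Matrix S S ℂ) ⊗ₖ Φ)ᴴ * ((1 : Matrix S S ℂ) ⊗ₖ σ) * ((1 : Matrix S S ℂ) ⊗ₖ Φ) := by
    simp only [conjTranspose_kronecker, conjTranspose_one, ← mul_kronecker_mul, Matrix.mul_one]
  rw [hsub]
  rfl

lemma conjTranspose_attach_mul_attach [DecidableEq C] [DecidableEq K] [DecidableEq T]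
    (hκ : Function.Injective fun c => (s c, κ c)) {Φ : Matrix T K ℂ} (hΦ : Φᴴ * Φ = 1) :
    (attach s κ Φ)ᴴ * attach s κ Φ = 1 := by
  simpa [hΦ, submatrix_one _ hκ] using
    conjTranspose_attach_mul_kronecker_mul (s := s) (κ := κ) Φ 1

lemma pinching_conjTranspose_attach_mul_kronecker_mul [DecidableEq C] [DecidableEq M] {μ : C → M}
    (hμ : Function.Injective fun c => (s c, μ c)) (Φ : Matrix T K ℂ) (σ : Matrix T T ℂ) :
    pinching μ ((attach s κ Φ)ᴴ * ((1 : Matrix S S ℂ) ⊗ₖ σ) * attach s κ Φ) =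
      diagonal fun c => (Φᴴ * σ * Φ) (κ c) (κ c) := by
  rw [conjTranspose_attach_mul_kronecker_mul]
  ext c c'
  by_cases h : c = c'
  · subst h
    simp [pinching]
  have hne : μ c = μ c' → s c ≠ s c' := fun hm hs => h (hμ (Prod.ext hs hm))
  by_cases hm : μ c = μ c' <;> simp [pinching, h, hm, hne]

variable [Fintype C] [DecidableEq C] [Fintype K] [DecidableEq K]

lemma attach_mul_conjTranspose_le (hκ : Function.Injective fun c => (s c, κ c))
    (Φ : Matrix T K ℂ) :
    attach s κ Φ * (attach s κ Φ)ᴴ ≤ (1 : Matrix S S ℂ) ⊗ₖ (Φ * Φᴴ) := by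
  set J : Matrix (S × K) C ℂ := (1 : Matrix (S × K) (S × K) ℂ).submatrix id fun c => (s c, κ c)
  have hJ : Jᴴ * J = 1 := by
    rw [conjTranspose_submatrix, conjTranspose_one, ← submatrix_mul _ _ _ _ _ Function.bijective_id,
      Matrix.mul_one, submatrix_one _ hκ]
  have hfactor : attach s κ Φ = ((1 : Matrix S S ℂ) ⊗ₖ Φ) * J := by
    rw [← submatrix_id_id ((1 : Matrix S S ℂ) ⊗ₖ Φ),
      ← submatrix_mul _ _ _ _ _ Function.bijective_id, Matrix.mul_one, attach]
  calc attach s κ Φ * (attach s κ Φ)ᴴ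
      = ((1 : Matrix S S ℂ) ⊗ₖ Φ) * (J * Jᴴ) * ((1 : Matrix S S ℂ) ⊗ₖ Φ)ᴴ := by
        simp only [hfactor, conjTranspose_mul, Matrix.mul_assoc]
    _ ≤ ((1 : Matrix S S ℂ) ⊗ₖ Φ) * 1 * ((1 : Matrix S S ℂ) ⊗ₖ Φ)ᴴ :=
        mul_mul_conjTranspose_mono (mul_conjTranspose_self_le_one hJ) _
    _ = (1 : Matrix S S ℂ) ⊗ₖ (Φ * Φᴴ) := by
        rw [Matrix.mul_one, conjTranspose_kronecker, conjTranspose_one, ← mul_kronecker_mul,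
          Matrix.mul_one]

lemma attach_mul_diagonal_mul_conjTranspose_le (hκ : Function.Injective fun c => (s c, κ c))
    (Φ : Matrix T K ℂ) {w : K → ℝ} (hw : ∀ k, 0 ≤ w k) :
    attach s κ Φ * diagonal (fun c => (w (κ c) : ℂ)) * (attach s κ Φ)ᴴ ≤
      (1 : Matrix S S ℂ) ⊗ₖ (Φ * diagonal (fun k => (w k : ℂ)) * Φᴴ) := by
  set d : K → ℂ := fun k => (√(w k) : ℂ)
  have hd (k : K) : (w k : ℂ) = d k * star (d k) := by
    rw [RCLike.star_def, Complex.conj_ofReal, ← Complex.ofReal_mul, Real.mul_self_sqrt (hw k)]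
  have hC : diagonal (fun c => (w (κ c) : ℂ)) =
      diagonal (fun c => d (κ c)) * (diagonal fun c => d (κ c))ᴴ := by
    simp only [hd, diagonal_conjTranspose, diagonal_mul_diagonal, Pi.star_apply]
  have hK : diagonal (fun k => (w k : ℂ)) = diagonal d * (diagonal d)ᴴ := by
    simp only [hd, diagonal_conjTranspose, diagonal_mul_diagonal, Pi.star_apply]
  rw [hC, hK]
  convert attach_mul_conjTranspose_le hκ (Φ * diagonal d) using 1
  · simp only [← attach_mul_diagonal, conjTranspose_mul, Matrix.mul_assoc]
  · simp only [conjTranspose_mul, Matrix.mul_assoc]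

end Attach

section Smoothing

lemma one_sub_sq_le_fidelity {a : Type*} [Fintype a] [DecidableEq a] {ρ' ρ : Matrix a a ℂ} {ε : ℝ}
    (hε : 0 ≤ ε) (hρ : ρ.trace = 1) (h : purifiedDistance ρ' ρ ≤ ε) :
    1 - ε ^ 2 ≤ fidelity ρ' ρ := by
  rw [purifiedDistance, generalizedFidelity, hρ, Real.sqrt_le_left hε] at h
  simp only [Complex.one_re, sub_self, mul_zero, Real.sqrt_zero, add_zero] at h
  nlinarith [fidelity_nonneg ρ' ρ, sq_nonneg ε]

lemma smoothCondMinEntropy_le_condMinEntropy {A B : Type*} [Fintype A] [DecidableEq A] [Fintype B]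
    [DecidableEq B] {ε : ℝ} {ρ τ : Matrix (A × B) (A × B) ℂ}
    (h : ∀ ρ' ∈ subnormalizedStates (A × B), purifiedDistance ρ' ρ ≤ ε →
      ∀ σ ∈ subnormalizedStates B, ∀ t : ℝ, ρ' ≤ ((2 : ℝ) ^ t) • ((1 : Matrix A A ℂ) ⊗ₖ σ) →
        ∃ σ' ∈ subnormalizedStates B, τ ≤ ((2 : ℝ) ^ t) • ((1 : Matrix A A ℂ) ⊗ₖ σ')) :
    smoothCondMinEntropy ε ρ ≤ condMinEntropy τ := by
  refine iSup₂_le fun ρ' hρ' => iSup_le fun hP => iSup₂_le fun σ hσ => ?_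
  rw [condMinEntropyRel, EReal.neg_le]
  refine le_iInf₂ fun t ht => ?_
  obtain ⟨σ', hσ', hle⟩ := h ρ' hρ' hP σ hσ t ht
  rw [EReal.neg_le]
  refine le_trans ?_ (le_iSup₂ (f := fun σ _ => condMinEntropyRel τ σ) σ' hσ')
  rw [condMinEntropyRel, EReal.neg_le_neg_iff]
  exact iInf₂_le t hle

variable {I C K M S T : Type*} [Fintype C] [DecidableEq C] [DecidableEq M]

lemma sum_pinching_pureState_mul_le {H : Type*} [Fintype H] {μ : C → M} {v : C → ℂ}
    {θ : H → C → ℂ} {d : C → ℝ} (hd : ∀ c, 0 ≤ d c) (hθ : ∀ c, ∑ h, ‖θ h c‖ ^ 2 ≤ 1)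
    (hv : pinching μ (pureState v) ≤ diagonal fun c => (d c : ℂ)) :
    ∑ h, pinching μ (pureState fun c => θ h c * v c) ≤ diagonal fun c => (d c : ℂ) := by
  have hmul (h : H) : (fun c => θ h c * v c) = diagonal (θ h) *ᵥ v := by
    ext c
    rw [mulVec_diagonal]
  have hentry (h : H) (c : C) : θ h c * d c * star (θ h c) = ((‖θ h c‖ ^ 2 * d c : ℝ) : ℂ) := by
    rw [mul_right_comm, RCLike.star_def, Complex.mul_conj']
    push_cast
    rfl
  have hdiag : ∑ h, diagonal (θ h) * diagonal (fun c => (d c : ℂ)) * (diagonal (θ h))ᴴ =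
      diagonal fun c => (((∑ h, ‖θ h c‖ ^ 2) * d c : ℝ) : ℂ) := by
    simp only [diagonal_conjTranspose, diagonal_mul_diagonal, Pi.star_apply, hentry]
    ext c c'
    by_cases h : c = c' <;> simp [Matrix.sum_apply, h, Finset.sum_mul]
  calc ∑ h, pinching μ (pureState fun c => θ h c * v c)
      = ∑ h, diagonal (θ h) * pinching μ (pureState v) * (diagonal (θ h))ᴴ := by
        refine Finset.sum_congr rfl fun h _ => ?_
        rw [hmul, ← mul_pureState_mul_conjTranspose, diagonal_conjTranspose,
          pinching_diagonal_mul_mul]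
    _ ≤ diagonal fun c => (((∑ h, ‖θ h c‖ ^ 2) * d c : ℝ) : ℂ) :=
        hdiag ▸ Finset.sum_le_sum fun h _ => mul_mul_conjTranspose_mono hv _
    _ ≤ diagonal fun c => (d c : ℂ) := diagonal_ofReal_mono fun c =>
        mul_le_of_le_one_left (hd c) (hθ c)

lemma exists_pinching_pureState_le [Fintype I] [DecidableEq I] [Fintype M] {μ : C → M} {a : C → ℝ}
    (ha : ∀ c, 0 ≤ a c) (ha1 : ∑ c, a c ^ 2 = 1) {W : Matrix I C ℂ} (hW : Wᴴ * W = 1)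
    {ρ : Matrix I I ℂ} (hρ : ρ ∈ subnormalizedStates I) {ε : ℝ} (hε : 0 ≤ ε)
    (hP : purifiedDistance ρ (W * pinching μ (pureState fun c => (a c : ℂ)) * Wᴴ) ≤ ε) :
    ∃ v : C → ℂ, pinching μ (pureState v) ≤ pinching μ (Wᴴ * ρ * W) ∧
      ∑ c, ‖v c‖ ^ 2 ≤ 1 ∧ 1 - ε ^ 2 ≤ ∑ c, a c * ‖v c‖ := by
  have htrace : (W * pinching μ (pureState fun c => (a c : ℂ)) * Wᴴ).trace = 1 := by
    rw [trace_mul_comm, ← Matrix.mul_assoc, hW, Matrix.one_mul, trace_pinching, trace_pureState]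
    simp [ha1]
  obtain ⟨v, hv, hF⟩ := exists_fidelity_pinching_le (μ := μ)
    (hρ.1.conjTranspose_mul_mul_same W) fun c => (a c : ℂ)
  refine ⟨v, hv, ?_, ?_⟩
  · have h := (trace_re_mono hv).trans ((trace_pinching (μ := μ) (Wᴴ * ρ * W)).symm ▸
      (trace_conjTranspose_mul_mul_re_le hW hρ.1).trans hρ.2)
    rwa [trace_pinching, trace_pureState, Complex.ofReal_re] at h
  · refine (one_sub_sq_le_fidelity hε htrace hP).trans ?_
    rw [fidelity_mul_mul_conjTranspose hρ.1 (posSemidef_pinching_pureState _)]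
    refine hF.trans ((Complex.re_le_norm _).trans ((norm_sum_le _ _).trans_eq ?_))
    refine Finset.sum_congr rfl fun c _ => ?_
    simp [abs_of_nonneg (ha c)]

lemma exists_norm_le_one_mul_eq {x v : ℂ} (h : ‖x‖ ≤ ‖v‖) : ∃ θ : ℂ, ‖θ‖ ≤ 1 ∧ θ * v = x :=
  ⟨x / v, norm_div x v ▸ div_le_one_of_le₀ h (norm_nonneg v),
    div_mul_cancel_of_imp fun hv => by simpa [hv] using h⟩

lemma min_div_mul_le {x y : ℝ} (hx : 0 ≤ x) (hy : 0 ≤ y) : min 1 (y / x) * x ≤ y := by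
  rcases hx.eq_or_lt with rfl | hx
  · simpa using hy
  · exact (mul_le_mul_of_nonneg_right (min_le_right _ _) hx.le).trans_eq (div_mul_cancel₀ y hx.ne')

lemma mul_diagonal_mul_conjTranspose_mem_subnormalizedStates [Fintype K] [DecidableEq K]
    [Fintype T] {Φ : Matrix T K ℂ} (hΦ : ∀ k, ∑ b, ‖Φ b k‖ ^ 2 ≤ 1) {w : K → ℝ}
    (hw : ∀ k, 0 ≤ w k) (hw1 : ∑ k, w k ≤ 1) :
    Φ * diagonal (fun k => (w k : ℂ)) * Φᴴ ∈ subnormalizedStates T := by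
  refine ⟨(PosSemidef.diagonal fun k => by simpa using hw k).mul_mul_conjTranspose_same Φ, ?_⟩
  have htrace : (Φ * diagonal (fun k => (w k : ℂ)) * Φᴴ).trace =
      ((∑ k, w k * ∑ b, ‖Φ b k‖ ^ 2 : ℝ) : ℂ) := by
    rw [Matrix.mul_assoc, trace_mul_comm, Matrix.mul_assoc, trace]
    push_cast
    refine Finset.sum_congr rfl fun k _ => ?_
    rw [diag_apply, diagonal_mul, Matrix.mul_apply]
    simp only [conjTranspose_apply, RCLike.star_def, Complex.conj_mul']
  rw [htrace, Complex.ofReal_re]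
  exact (Finset.sum_le_sum fun k _ => mul_le_of_le_one_right (hw k) (hΦ k)).trans hw1

variable [Fintype K] [DecidableEq K] [Fintype S] [DecidableEq S] [Fintype T] [DecidableEq T]
  {s : C → S} {κ : C → K} {μ : C → M} {Φ : Matrix T K ℂ} {a : C → ℝ}

lemma exists_isGentleFilter_isFilterBound [Fintype M] (hκ : Function.Injective fun c => (s c, κ c))
    (hμ : Function.Injective fun c => (s c, μ c)) (hΦ : Φᴴ * Φ = 1) (ha : ∀ c, 0 ≤ a c)
    (ha1 : ∑ c, a c ^ 2 = 1) {ε l : ℝ} (hε : 0 ≤ ε) (hl : 0 ≤ l)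
    {ρ : Matrix (S × T) (S × T) ℂ} (hρ : ρ ∈ subnormalizedStates (S × T))
    (hP : purifiedDistance ρ
      (attach s κ Φ * pinching μ (pureState fun c => (a c : ℂ)) * (attach s κ Φ)ᴴ) ≤ ε)
    {σ : Matrix T T ℂ} (hσ : σ ∈ subnormalizedStates T)
    (hle : ρ ≤ l • ((1 : Matrix S S ℂ) ⊗ₖ σ)) :
    ∃ Q w, IsGentleFilter a (2 * ε) Q ∧ IsFilterBound κ μ a l Q w := by
  obtain ⟨v, hv, hv1, hav⟩ := exists_pinching_pureState_le ha ha1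
    (conjTranspose_attach_mul_attach hκ hΦ) hρ hε hP
  have hQv (c : C) : ‖((min 1 (‖v c‖ / a c) * a c : ℝ) : ℂ)‖ ≤ ‖v c‖ := by
    have hmin := le_min zero_le_one (div_nonneg (norm_nonneg (v c)) (ha c))
    rw [Complex.norm_of_nonneg (mul_nonneg hmin (ha c))]
    exact min_div_mul_le (ha c) (norm_nonneg _)
  choose θ hθ hθv using fun c => exists_norm_le_one_mul_eq (hQv c)
  have hτ : (Φᴴ * σ * Φ).PosSemidef := hσ.1.conjTranspose_mul_mul_same Φ
  have hdiag (k : K) : (((Φᴴ * σ * Φ) k k).re : ℂ) = (Φᴴ * σ * Φ) k k :=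
    Complex.conj_eq_iff_re.1 (hτ.isHermitian.apply k k)
  have hw (k : K) : 0 ≤ ((Φᴴ * σ * Φ) k k).re := (Complex.nonneg_iff.1 hτ.diag_nonneg).1
  have hpinch : pinching μ (pureState v) ≤
      diagonal fun c => ((l * ((Φᴴ * σ * Φ) (κ c) (κ c)).re : ℝ) : ℂ) := by
    refine (hv.trans (pinching_mono (conjTranspose_mul_mul_mono hle _))).trans_eq ?_
    rw [Matrix.mul_smul, Matrix.smul_mul, pinching_smul,
      pinching_conjTranspose_attach_mul_kronecker_mul hμ, ← diagonal_smul]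
    congr! 2 with c
    simp [hdiag]
  refine ⟨_, fun k => ((Φᴴ * σ * Φ) k k).re,
    isGentleFilter_min_div hε ha (fun c => norm_nonneg (v c)) ha1 hv1 hav, hw, ?_, ?_⟩
  · rw [← Complex.re_sum]
    exact (trace_conjTranspose_mul_mul_re_le hΦ hσ.1).trans hσ.2
  · have h := sum_pinching_pureState_mul_le (H := Unit) (θ := fun _ => θ)
      (fun c => mul_nonneg hl (hw (κ c))) (fun c => by simpa using hθ c) hpinch
    simpa [hθv, -Complex.ofReal_mul] using h

lemma IsFilterBound.sum_attach_le (hκ : Function.Injective fun c => (s c, κ c)) {l : ℝ}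
    (hl : 0 ≤ l) {Q : C → ℝ} {w : K → ℝ} (hQ : IsFilterBound κ μ a l Q w) (Φ : Matrix T K ℂ)
    {H : Type*} [Fintype H] {θ : H → C → ℂ} (hθ : ∀ c, ∑ h, ‖θ h c‖ ^ 2 ≤ 1) :
    ∑ h, attach s κ Φ * pinching μ (pureState fun c => θ h c * (Q c * a c : ℝ)) *
      (attach s κ Φ)ᴴ ≤
      l • ((1 : Matrix S S ℂ) ⊗ₖ (Φ * diagonal (fun k => (w k : ℂ)) * Φᴴ)) := by
  have hpinch := sum_pinching_pureState_mul_le (fun c => mul_nonneg hl (hQ.nonneg (κ c))) hθ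
    hQ.le_diagonal
  rw [← Matrix.sum_mul, ← Matrix.mul_sum]
  refine (mul_mul_conjTranspose_mono hpinch _).trans ?_
  have hsmul : diagonal (fun c => ((l * w (κ c) : ℝ) : ℂ)) =
      l • diagonal fun c => (w (κ c) : ℂ) := by
    rw [← diagonal_smul]
    congr! 1 with c
    ext c
    simp
  rw [hsmul, Matrix.mul_smul, Matrix.smul_mul]
  exact smul_le_smul_of_nonneg_left (attach_mul_diagonal_mul_conjTranspose_le hκ Φ hQ.nonneg) hl

theorem exists_isGentleFilter_smoothCondMinEntropy_le [Fintype M]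
    (hκ : Function.Injective fun c => (s c, κ c)) (hμ : Function.Injective fun c => (s c, μ c))
    (hΦ : Φᴴ * Φ = 1) (ha : ∀ c, 0 ≤ a c) (ha1 : ∑ c, a c ^ 2 = 1) {ε : ℝ} (hε : 0 ≤ ε)
    (H : Type*) [Fintype H] :
    ∃ Q, IsGentleFilter a (2 * ε) Q ∧ ∀ (θ : H → C → ℂ) (Ψ : Matrix T K ℂ),
      (∀ c, ∑ h, ‖θ h c‖ ^ 2 ≤ 1) → (∀ k, ∑ b, ‖Ψ b k‖ ^ 2 ≤ 1) →
      smoothCondMinEntropy ε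
          (attach s κ Φ * pinching μ (pureState fun c => (a c : ℂ)) * (attach s κ Φ)ᴴ) ≤
        condMinEntropy (∑ h, attach s κ Ψ *
          pinching μ (pureState fun c => θ h c * (Q c * a c : ℝ)) * (attach s κ Ψ)ᴴ) := by
  obtain ⟨Q, w, hQ, hbound⟩ := exists_isFilterBound_forall κ μ a (mul_nonneg zero_le_two hε)
  refine ⟨Q, hQ, fun θ Ψ hθ hΨ => smoothCondMinEntropy_le_condMinEntropy
    fun ρ hρ hP σ hσ t hle => ?_⟩
  have ht : (0 : ℝ) ≤ 2 ^ t := by positivity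
  have hw := hbound _ (exists_isGentleFilter_isFilterBound hκ hμ hΦ ha ha1 hε ht hρ hP hσ hle)
  exact ⟨_, mul_diagonal_mul_conjTranspose_mem_subnormalizedStates hΨ hw.nonneg hw.sum_le_one,
    hw.sum_attach_le hκ ht Ψ hθ⟩

end Smoothing

section Expand

variable {B C H K M : Type*} [Fintype H] [DecidableEq B]

/-- The matrix whose row `c` is the vector on `B` with the amplitude `g h c` at the basis element
`b (μ c) h`, for each `h`. -/
def expand (b : M → H → B) (μ : C → M) (g : H → C → ℂ) : Matrix C B ℂ :=
  Matrix.of fun c y => ∑ h, if b (μ c) h = y then g h c else 0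

variable [Fintype B] [DecidableEq M] {b : M → H → B}

lemma expand_mul_conjTranspose (hb : Function.Injective2 b) (μ : C → M) (g : H → C → ℂ) :
    expand b μ g * (expand b μ g)ᴴ = ∑ h, pinching μ (pureState (g h)) := by
  classical
  ext c c'
  by_cases hc : μ c = μ c'
  · simp [expand, Matrix.mul_apply, Matrix.sum_apply, pinching, pureState, vecMulVec_apply,
      Finset.sum_mul, Finset.sum_comm (s := (Finset.univ : Finset B)), apply_ite, hc,
      (hb.right (μ c')).eq_iff]
  · have hne (h h' : H) : b (μ c') h' ≠ b (μ c) h := fun e => hc (hb e).1.symm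
    simp [expand, Matrix.mul_apply, Matrix.sum_apply, pinching, Finset.sum_mul,
      Finset.sum_comm (s := (Finset.univ : Finset B)), apply_ite, hne, hc]

variable [DecidableEq K] {b : K → H → B}

lemma expand_id_mul_conjTranspose (hb : Function.Injective2 b) (v : H → K → ℂ) :
    expand b id v * (expand b id v)ᴴ = diagonal fun k => ((∑ h, ‖v h k‖ ^ 2 : ℝ) : ℂ) := by
  rw [expand_mul_conjTranspose hb]
  ext k k'
  by_cases hk : k = k'
  · subst hk
    simp [Matrix.sum_apply, pinching, pureState, vecMulVec_apply, Complex.mul_conj']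
  · simp [Matrix.sum_apply, pinching, hk]

lemma sum_norm_expand_id_sq (hb : Function.Injective2 b) (v : H → K → ℂ) (k : K) :
    ∑ y, ‖expand b id v k y‖ ^ 2 = ∑ h, ‖v h k‖ ^ 2 := by
  have h := congrFun₂ (expand_id_mul_conjTranspose hb v) k k
  rw [diagonal_apply_eq] at h
  rw [← Complex.ofReal_inj, ← h]
  simp [Matrix.mul_apply, Complex.mul_conj']

lemma conjTranspose_transpose_expand_id_mul (hb : Function.Injective2 b) {v : H → K → ℂ}
    (hv : ∀ k, ∑ h, ‖v h k‖ ^ 2 = 1) : (expand b id v)ᵀᴴ * (expand b id v)ᵀ = 1 := by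
  rw [conjTranspose_transpose_eq_transpose_conjTranspose, ← transpose_mul,
    expand_id_mul_conjTranspose hb]
  simp only [hv, Complex.ofReal_one, diagonal_one, transpose_one]

end Expand

/-! ### Labels of the edges -/

section Labels

variable {V : Type*} {G : SimpleGraph V}

/-- Both endpoints of the edge lie in `B`. -/
abbrev IsInside (B : Finset V) (e : G.edgeSet) : Prop := ∀ x ∈ (e : Sym2 V), x ∈ B

lemma IsInside.not_of_disjoint {B B' : Finset V} (hB : Disjoint B B') {e : G.edgeSet}
    (he : IsInside B e) : ¬IsInside B' e := fun he' =>
  Finset.disjoint_left.1 hB (he _ (Sym2.out_fst_mem _)) (he' _ (Sym2.out_fst_mem _))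

variable [Fintype V] [DecidableEq V]

/-- The edge has one endpoint in `B` and one in its complement. -/
abbrev Crosses (B : Finset V) (e : G.edgeSet) : Prop := ¬IsInside B e ∧ ¬IsInside Bᶜ e

variable (D : G.edgeSet → ℕ)

/-- A label for every edge. Both half-edges of an edge carry the same label in each term of a link
state, which is why link states are studied in terms of edge labels. -/
abbrev EdgeLabels : Type _ := (e : G.edgeSet) → Fin (D e)

/-- A label for every edge which satisfies `p`. -/
abbrev Labels (p : G.edgeSet → Prop) : Type _ := (e : {e // p e}) → Fin (D e)

/-- The labels of the edges inside `B`. -/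
abbrev InnerLabels (B : Finset V) : Type _ := Labels D (IsInside B)

/-- The labels of the edges between `B` and its complement. -/
abbrev CutLabels (B : Finset V) : Type _ := Labels D (Crosses B)

/-- The labels of the edges which are neither inside `T` nor inside `R`. These edges carry the
correlations between the two parts of a bipartite system `S ∪ T` with complement `R`. -/
abbrev CoreLabels (T R : Finset V) : Type _ := Labels D fun e => ¬IsInside T e ∧ ¬IsInside R e

variable {D}

/-- For disjoint `T` and `R`, the labels of all edges are the core labels together with the labels
inside `T` and those inside `R`. -/
def glue {T R : Finset V} (hTR : Disjoint T R) :
    CoreLabels D T R × InnerLabels D T × InnerLabels D R ≃ EdgeLabels D where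
  toFun p e := if hT : IsInside T e then p.2.1 ⟨e, hT⟩ else
    if hR : IsInside R e then p.2.2 ⟨e, hR⟩ else p.1 ⟨e, hT, hR⟩
  invFun x := (fun e => x e, fun e => x e, fun e => x e)
  left_inv p := by
    refine Prod.ext (funext fun e => ?_) (Prod.ext (funext fun e => ?_) (funext fun e => ?_))
    · simp only [dif_neg e.2.1, dif_neg e.2.2]
    · simp only [dif_pos e.2]
    · simp only [dif_pos e.2, dif_neg (e.2.not_of_disjoint hTR.symm)]
  right_inv x := by
    ext1 e
    dsimp only
    split_ifs <;> rfl

/-- The basis element of `H_S` in which all half-edges carry the label of their edge. -/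
def subDiag (S : Finset V) (x : EdgeLabels D) : SubConfig D S := fun h => x h.1.1

/-- The basis element of `H_B` given by the labels of the edges which cross `B` or lie inside. -/
def assemble (B : Finset V) (k : CutLabels D B) (z : InnerLabels D B) : SubConfig D B := fun h =>
  if he : IsInside B h.1.1 then z ⟨h.1.1, he⟩
  else k ⟨h.1.1, he, fun hc => Finset.mem_compl.1 (hc _ h.1.2.2) h.2⟩

lemma assemble_injective2 (B : Finset V) : Function.Injective2 (assemble (D := D) B) := by
  intro k k' z z' h
  constructor <;> ext1 e
  · obtain ⟨x, hx, hxB⟩ : ∃ x ∈ (e : Sym2 V), x ∈ B := by simpa using e.2.2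
    simpa only [assemble, dif_neg e.2.1] using congrFun h ⟨⟨e, x, hx⟩, hxB⟩
  · have hx := Sym2.out_fst_mem (e : Sym2 V)
    simpa only [assemble, dif_pos e.2] using congrFun h ⟨⟨e, _, hx⟩, e.2 _ hx⟩

end Labels

section Tripartition

variable {V : Type*} {G : SimpleGraph V}

/-- The vertex set is the disjoint union of `S`, `T` and `R`: the two parts of a bipartite system
and the environment which is traced out. -/
structure IsTripartition (S T R : Finset V) : Prop where
  disjoint_left : Disjoint S T
  disjoint_outer : Disjoint S R
  disjoint_right : Disjoint T R
  cover : ∀ x, x ∈ S ∨ x ∈ T ∨ x ∈ R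

variable {S T R : Finset V}

lemma IsTripartition.swap (h : IsTripartition S T R) : IsTripartition S R T :=
  ⟨h.2, h.1, h.3.symm, fun x => (h.4 x).imp_right Or.symm⟩

variable [Fintype V] [DecidableEq V]

lemma isTripartition_compl_union (hST : Disjoint S T) : IsTripartition S T (S ∪ T)ᶜ where
  disjoint_left := hST
  disjoint_outer := disjoint_compl_right.mono_left Finset.subset_union_left
  disjoint_right := disjoint_compl_right.mono_left Finset.subset_union_right
  cover x := by
    rw [Finset.mem_compl, Finset.mem_union]
    tauto

variable {D : G.edgeSet → ℕ}

/-- The core labels of the edges which touch `S`. -/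
def coreSub (h : IsTripartition S T R) (c : CoreLabels D T R) : SubConfig D S := fun x =>
  c ⟨x.1.1, fun e => Finset.disjoint_left.1 h.disjoint_left x.2 (e _ x.1.2.2),
    fun e => Finset.disjoint_left.1 h.disjoint_outer x.2 (e _ x.1.2.2)⟩

/-- The core labels of the edges which cross `T`. -/
def coreCutLeft (hTR : Disjoint T R) (c : CoreLabels D T R) : CutLabels D T := fun e =>
  c ⟨e, e.2.1, fun h => e.2.2 fun x hx => Finset.mem_compl.2 (Finset.disjoint_right.1 hTR (h x hx))⟩

/-- The core labels of the edges which cross `R`. -/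
def coreCutRight (hTR : Disjoint T R) (c : CoreLabels D T R) : CutLabels D R := fun e =>
  c ⟨e, fun h => e.2.2 fun x hx => Finset.mem_compl.2 (Finset.disjoint_left.1 hTR (h x hx)), e.2.1⟩

lemma IsTripartition.crosses (h : IsTripartition S T R) {e : G.edgeSet}
    (hS : ∀ x ∈ (e : Sym2 V), x ∉ S) (hT : ¬IsInside T e) (hR : ¬IsInside R e) : Crosses T e :=
  ⟨hT, fun hc => hR fun x hx =>
    ((h.cover x).resolve_left (hS x hx)).resolve_left (Finset.mem_compl.1 (hc x hx))⟩

lemma injective_coreSub_coreCutLeft (h : IsTripartition S T R) :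
    Function.Injective fun c : CoreLabels D T R =>
      (coreSub h c, coreCutLeft h.disjoint_right c) := by
  intro c c' hc
  ext1 e
  by_cases hS : ∃ x ∈ (e : Sym2 V), x ∈ S
  · obtain ⟨x, hx, hxS⟩ := hS
    exact congrFun (congrArg Prod.fst hc) ⟨⟨e, x, hx⟩, hxS⟩
  · exact congrFun (congrArg Prod.snd hc)
      ⟨e, h.crosses (fun x hx hxS => hS ⟨x, hx, hxS⟩) e.2.1 e.2.2⟩

lemma injective_coreSub_coreCutRight (h : IsTripartition S T R) :
    Function.Injective fun c : CoreLabels D T R =>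
      (coreSub h c, coreCutRight h.disjoint_right c) := by
  intro c c' hc
  ext1 e
  by_cases hS : ∃ x ∈ (e : Sym2 V), x ∈ S
  · obtain ⟨x, hx, hxS⟩ := hS
    exact congrFun (congrArg Prod.fst hc) ⟨⟨e, x, hx⟩, hxS⟩
  · exact congrFun (congrArg Prod.snd hc)
      ⟨e, h.swap.crosses (fun x hx hxS => hS ⟨x, hx, hxS⟩) e.2.2 e.2.1⟩

lemma subDiag_glue_outer (h : IsTripartition S T R)
    (p : CoreLabels D T R × InnerLabels D T × InnerLabels D R) :
    subDiag S (glue h.disjoint_right p) = coreSub h p.1 := by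
  ext1 x
  have hT : ¬IsInside T x.1.1 := fun e => Finset.disjoint_left.1 h.1 x.2 (e _ x.1.2.2)
  have hR : ¬IsInside R x.1.1 := fun e => Finset.disjoint_left.1 h.2 x.2 (e _ x.1.2.2)
  simp [subDiag, glue, coreSub, hT, hR]

lemma subDiag_glue_left (hTR : Disjoint T R)
    (p : CoreLabels D T R × InnerLabels D T × InnerLabels D R) :
    subDiag T (glue hTR p) = assemble T (coreCutLeft hTR p.1) p.2.1 := by
  ext1 x
  by_cases hT : IsInside T x.1.1
  · simp only [subDiag, glue, Equiv.coe_fn_mk, assemble, dif_pos hT]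
  · have hR : ¬IsInside R x.1.1 := fun e => Finset.disjoint_left.1 hTR x.2 (e _ x.1.2.2)
    simp [subDiag, glue, assemble, coreCutLeft, hT, hR]

lemma factorsThrough_subDiag_glue_left (hTR : Disjoint T R) :
    Function.FactorsThrough (fun p => subDiag (D := D) T (glue hTR p))
      fun p => (coreCutLeft hTR p.1, p.2.1) := by
  intro p p' h
  simp only [subDiag_glue_left]
  exact congrArg (fun q => assemble T q.1 q.2) h

lemma subDiag_glue_right (hTR : Disjoint T R)
    (p : CoreLabels D T R × InnerLabels D T × InnerLabels D R) :
    subDiag R (glue hTR p) = assemble R (coreCutRight hTR p.1) p.2.2 := by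
  ext1 x
  have hT : ¬IsInside T x.1.1 := fun e => Finset.disjoint_left.1 hTR (e _ x.1.2.2) x.2
  by_cases hR : IsInside R x.1.1 <;> simp [subDiag, glue, assemble, coreCutRight, hT, hR]

lemma factorsThrough_glue_symm_fst (hTR : Disjoint T R) :
    Function.FactorsThrough (fun x : EdgeLabels D => ((glue hTR).symm x).1) (subDiag Tᶜ) := by
  intro x x' h
  ext1 e
  obtain ⟨y, hy, hyT⟩ : ∃ y ∈ (e : Sym2 V), y ∉ T := by simpa using e.2.1
  exact congrFun h ⟨⟨e, y, hy⟩, Finset.mem_compl.2 hyT⟩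

lemma factorsThrough_subDiag_compl_glue (hTR : Disjoint T R) :
    Function.FactorsThrough (fun p => subDiag (D := D) Tᶜ (glue hTR p))
      fun p => (p.1, p.2.2) := by
  rintro ⟨c, z, h⟩ ⟨c', z', h'⟩ e
  obtain ⟨rfl, rfl⟩ : c = c' ∧ h = h' := by simpa using e
  ext1 x
  have hT : ¬IsInside T x.1.1 := fun e => Finset.mem_compl.1 x.2 (e _ x.1.2.2)
  simp [subDiag, glue, hT]

end Tripartition

/-! ### Filtered link states -/

section Amplitude

variable {I : Type*} [Fintype I] {n : I → ℕ}

/-- The amplitude at `x` of the product of the vectors `∑ j, √(l i j) |j⟩` over all `i`. -/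
def amplitude (l : (i : I) → Fin (n i) → ℝ) (x : (i : I) → Fin (n i)) : ℝ := ∏ i, √(l i (x i))

lemma amplitude_nonneg (l : (i : I) → Fin (n i) → ℝ) (x : (i : I) → Fin (n i)) :
    0 ≤ amplitude l x := Finset.prod_nonneg fun _ _ => Real.sqrt_nonneg _

lemma sum_amplitude_sq [DecidableEq I] {l : (i : I) → Fin (n i) → ℝ} (hl : ∀ i j, 0 ≤ l i j)
    (hl1 : ∀ i, ∑ j, l i j = 1) : ∑ x, amplitude l x ^ 2 = 1 := by
  calc ∑ x, amplitude l x ^ 2 = ∑ x : (i : I) → Fin (n i), ∏ i, l i (x i) :=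
        Finset.sum_congr rfl fun x _ => by
          simp only [amplitude, ← Finset.prod_pow, Real.sq_sqrt (hl _ _)]
    _ = ∏ i, ∑ j, l i j := (Fintype.prod_sum l).symm
    _ = 1 := by simp only [hl1, Finset.prod_const_one]

lemma amplitude_subtype (l : (i : I) → Fin (n i) → ℝ) (p : I → Prop) [DecidablePred p]
    (x : (i : I) → Fin (n i)) :
    amplitude (fun i : {i // p i} => l i) (fun i => x i) =
      ∏ i, if p i then √(l i (x i)) else 1 := by
  rw [← Finset.prod_filter, ← Finset.prod_subtype_eq_prod_filter, Finset.subtype_univ]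
  rfl

end Amplitude

section LinkAmplitude

variable {V : Type*} [Fintype V] [DecidableEq V] {G : SimpleGraph V} [DecidableRel G.Adj]
  {D : G.edgeSet → ℕ}

/-- The factor of the amplitude of a link state which comes from the edges satisfying `p`. -/
abbrev labelAmplitude (lam : (e : G.edgeSet) → Fin (D e) → ℝ) {p : G.edgeSet → Prop}
    [DecidablePred p] (x : Labels D p) : ℝ := amplitude (fun e : {e // p e} => lam e) x

lemma amplitude_glue {T R : Finset V} (hTR : Disjoint T R) (lam : (e : G.edgeSet) → Fin (D e) → ℝ)
    (p : CoreLabels D T R × InnerLabels D T × InnerLabels D R) :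
    amplitude lam (glue hTR p) =
      labelAmplitude lam p.1 * (labelAmplitude lam p.2.1 * labelAmplitude lam p.2.2) := by
  obtain ⟨x, rfl⟩ := (glue hTR).symm.surjective p
  rw [Equiv.apply_symm_apply]
  refine Eq.trans ?_ (congrArg₂ _ (amplitude_subtype lam _ x)
    (congrArg₂ _ (amplitude_subtype lam _ x) (amplitude_subtype lam _ x))).symm
  simp only [← Finset.prod_mul_distrib, amplitude]
  refine Finset.prod_congr rfl fun e _ => ?_
  by_cases hT : IsInside T e
  · rw [if_neg fun h => h.1 hT, if_pos hT, if_neg (hT.not_of_disjoint hTR), one_mul, mul_one]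
  by_cases hR : IsInside R e
  · rw [if_neg fun h => h.2 hR, if_neg hT, if_pos hR, one_mul, one_mul]
  · rw [if_pos ⟨hT, hR⟩, if_neg hT, if_neg hR, one_mul, mul_one]

end LinkAmplitude

section DiagVec

variable {V : Type*} {G : SimpleGraph V} {D : G.edgeSet → ℕ}

/-- The basis element of `H_V` in which all half-edges carry the label of their edge. -/
def diag (x : EdgeLabels D) : Config D := fun h => x h.1

lemma diag_injective : Function.Injective (diag (D := D)) := fun _ _ h =>
  funext fun e => congrFun h ⟨e, _, Sym2.out_fst_mem (e : Sym2 V)⟩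

variable [Fintype V] [DecidableEq V]

lemma join_eq_diag_iff {S T : Finset V} (hST : Disjoint S T) (s : SubConfig D S)
    (t : SubConfig D T) (r : SubConfig D (S ∪ T)ᶜ) (x : EdgeLabels D) :
    join S T s t r = diag x ↔ s = subDiag S x ∧ t = subDiag T x ∧ r = subDiag (S ∪ T)ᶜ x := by
  constructor
  · intro h
    refine ⟨funext fun ⟨h', hS⟩ => ?_, funext fun ⟨h', hT⟩ => ?_, funext fun ⟨h', hR⟩ => ?_⟩
    · simpa [join, diag, subDiag, hS] using congrFun h h'
    · have hS : h'.2.1 ∉ S := fun hS => Finset.disjoint_left.1 hST hS hT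
      simpa [join, diag, subDiag, hS, hT] using congrFun h h'
    · obtain ⟨hS, hT⟩ : h'.2.1 ∉ S ∧ h'.2.1 ∉ T := by simpa using hR
      simpa [join, diag, subDiag, hS, hT] using congrFun h h'
  · rintro ⟨rfl, rfl, rfl⟩
    ext1 h
    simp only [join, diag, subDiag]
    split_ifs <;> rfl

variable [DecidableRel G.Adj]

/-- The vector `∑ x, f x |diag x⟩`. -/
def diagVec (f : EdgeLabels D → ℝ) : Config D → ℂ := fun c =>
  ∑ x, if c = diag x then (f x : ℂ) else 0

lemma diagVec_diag (f : EdgeLabels D → ℝ) (x : EdgeLabels D) : diagVec f (diag x) = f x := by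
  simp [diagVec, diag_injective.eq_iff]

lemma star_diagVec_dotProduct (f : EdgeLabels D → ℝ) (ψ : Config D → ℂ) :
    star (diagVec f) ⬝ᵥ ψ = ∑ x, f x * ψ (diag x) := by
  simp only [dotProduct, Pi.star_apply, diagVec, star_sum, Finset.sum_mul]
  rw [Finset.sum_comm]
  simp [apply_ite]

lemma sum_norm_diagVec_sq (f : EdgeLabels D → ℝ) : ∑ c, ‖diagVec f c‖ ^ 2 = ∑ x, f x ^ 2 := by
  have h := star_diagVec_dotProduct f (diagVec f)
  simp only [diagVec_diag, dotProduct, Pi.star_apply, RCLike.star_def, Complex.conj_mul'] at h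
  rw [← Complex.ofReal_inj]
  simpa only [Complex.ofReal_sum, Complex.ofReal_mul, sq] using h

lemma linkVector_eq_diagVec (lam : (e : G.edgeSet) → Fin (D e) → ℝ) :
    linkVector lam = diagVec (amplitude lam) := by
  ext c
  have hedge (e : G.edgeSet) : edgeVector e (lam e) (fun x => c ⟨e, x⟩) =
      ∑ i, if (fun x => c ⟨e, x⟩) = (fun _ => i) then ((√(lam e i) : ℝ) : ℂ) else 0 := by
    simp [edgeVector, Finset.sum_apply, Pi.single_apply]
  simp only [linkVector, hedge, Fintype.prod_sum, Finset.prod_ite_zero, Finset.mem_univ,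
    true_imp_iff, diagVec, amplitude, Complex.ofReal_prod]
  refine Finset.sum_congr rfl fun x _ => if_congr ⟨fun h => ?_, ?_⟩ rfl rfl
  · ext1 ⟨e, a⟩
    exact congrFun (h e) a
  · rintro rfl e
    rfl

end DiagVec

section ReducedState

variable {V : Type*} [Fintype V] [DecidableEq V] {G : SimpleGraph V} [DecidableRel G.Adj]
  {D : G.edgeSet → ℕ} {S T : Finset V}

lemma reducedState_pureState_eq_mul {I : Type*} [Fintype I] {ψ : Config D → ℂ}
    {A : Matrix (SubConfig D S × SubConfig D T) I ℂ} {X : Matrix I (SubConfig D (S ∪ T)ᶜ) ℂ}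
    (h : ∀ s t r, ψ (join S T s t r) = (A * X) (s, t) r) :
    reducedState (pureState ψ) S T = A * (X * Xᴴ) * Aᴴ := by
  have hsquare : A * (X * Xᴴ) * Aᴴ = A * X * (A * X)ᴴ := by
    simp only [conjTranspose_mul, Matrix.mul_assoc]
  rw [hsquare]
  ext p q
  simp only [reducedState, pureState, vecMulVec_apply, Pi.star_apply, h,
    Matrix.mul_apply (M := A * X)]
  rfl

/-- The operator on `T` which sends the labels of the edges crossing `T` to the vector with the
amplitudes `v` over the labels inside `T`. -/
abbrev expandLeft (v : InnerLabels D T → CutLabels D T → ℂ) :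
    Matrix (SubConfig D T) (CutLabels D T) ℂ := (expand (assemble T) id v)ᵀ

theorem reducedState_pureState_diagVec (hP : IsTripartition S T (S ∪ T)ᶜ) {f : EdgeLabels D → ℝ}
    {g : InnerLabels D (S ∪ T)ᶜ → CoreLabels D T (S ∪ T)ᶜ → ℂ}
    {v : InnerLabels D T → CutLabels D T → ℂ}
    (hf : ∀ c z h, (f (glue hP.disjoint_right (c, z, h)) : ℂ) =
      g h c * v z (coreCutLeft hP.disjoint_right c)) :
    reducedState (pureState (diagVec f)) S T =
      ∑ h, attach (coreSub hP) (coreCutLeft hP.disjoint_right) (expandLeft v) *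
        pinching (coreCutRight hP.disjoint_right) (pureState (g h)) *
        (attach (coreSub hP) (coreCutLeft hP.disjoint_right) (expandLeft v))ᴴ := by
  rw [← Matrix.sum_mul, ← Matrix.mul_sum, ← expand_mul_conjTranspose (assemble_injective2 _)]
  refine reducedState_pureState_eq_mul fun s t r => ?_
  rw [diagVec, ← (glue hP.disjoint_right).sum_comp, Fintype.sum_prod_type, Matrix.mul_apply]
  refine Finset.sum_congr rfl fun c _ => ?_
  simp only [Fintype.sum_prod_type, join_eq_diag_iff hP.disjoint_left, subDiag_glue_outer hP,
    subDiag_glue_left, subDiag_glue_right, hf]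
  rw [Finset.sum_comm]
  simp only [attach, expand, submatrix_apply, kroneckerMap_apply, transpose_apply, of_apply, id_eq,
    Matrix.one_apply, Finset.sum_mul, Finset.mul_sum]
  exact Finset.sum_congr rfl fun h _ => Finset.sum_congr rfl fun z _ => by grind

end ReducedState

section Factor

lemma exists_abs_le_one_factor {X Y : Type*} {f : X → ℝ} {g : X → Y} (hf : ∀ x, |f x| ≤ 1)
    (h : f.FactorsThrough g) : ∃ f' : Y → ℝ, (∀ y, |f' y| ≤ 1) ∧ ∀ x, f x = f' (g x) := by
  refine ⟨Function.extend g f 0, fun y => ?_, fun x => (h.extend_apply 0 x).symm⟩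
  by_cases hy : ∃ x, g x = y
  · obtain ⟨x, rfl⟩ := hy
    exact (h.extend_apply 0 x).symm ▸ hf x
  · simp [Function.extend_apply' _ _ _ hy]

lemma factorsThrough_finset_prod {X Y κ : Type*} {P : κ → X → ℝ} {g : X → Y}
    (hP : ∀ k, (P k).FactorsThrough g) (s : Finset κ) :
    Function.FactorsThrough (fun x => ∏ k ∈ s, P k x) g := fun _ _ h =>
  Finset.prod_congr rfl fun k _ => hP k h

lemma sum_norm_ofReal_mul_sq_le_one {X : Type*} [Fintype X] {f p : X → ℝ} (hf : ∀ x, |f x| ≤ 1)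
    (hp : ∑ x, p x ^ 2 = 1) : ∑ x, ‖((f x * p x : ℝ) : ℂ)‖ ^ 2 ≤ 1 := by
  refine hp ▸ Finset.sum_le_sum fun x _ => ?_
  rw [Complex.norm_real, Real.norm_eq_abs, sq_abs, mul_pow]
  exact mul_le_of_le_one_left (sq_nonneg _) ((sq_le_one_iff_abs_le_one _).2 (hf x))

end Factor

section GraphFilter

variable {V : Type*} [Fintype V] [DecidableEq V] {G : SimpleGraph V} [DecidableRel G.Adj]
  {D : G.edgeSet → ℕ} {lam : (e : G.edgeSet) → Fin (D e) → ℝ} {S T R : Finset V}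

lemma sum_labelAmplitude_sq (hlam_nonneg : ∀ e i, 0 ≤ lam e i) (hlam_sum : ∀ e, ∑ i, lam e i = 1)
    (p : G.edgeSet → Prop) [DecidablePred p] : ∑ z : Labels D p, labelAmplitude lam z ^ 2 = 1 :=
  sum_amplitude_sq (fun e => hlam_nonneg e) fun e => hlam_sum e

lemma IsGentleFilter.comp_glue_symm (hlam_nonneg : ∀ e i, 0 ≤ lam e i)
    (hlam_sum : ∀ e, ∑ i, lam e i = 1) (hTR : Disjoint T R) {δ : ℝ} {Q : CoreLabels D T R → ℝ}
    (hQ : IsGentleFilter (labelAmplitude lam) δ Q) :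
    IsGentleFilter (amplitude lam) δ fun x => Q ((glue hTR).symm x).1 where
  nonneg x := hQ.nonneg _
  le_one x := hQ.le_one _
  loss := by
    rw [← (glue hTR).sum_comp]
    simp only [Equiv.symm_apply_apply, amplitude_glue, Fintype.sum_prod_type, mul_pow]
    refine le_of_eq_of_le (Finset.sum_congr rfl fun c _ => ?_) hQ.loss
    simp only [mul_comm _ (1 - Q c), ← Finset.mul_sum,
      sum_labelAmplitude_sq hlam_nonneg hlam_sum, mul_one]

lemma reducedState_linkState (hP : IsTripartition S T (S ∪ T)ᶜ) (hlam_nonneg : ∀ e i, 0 ≤ lam e i)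
    (hlam_sum : ∀ e, ∑ i, lam e i = 1) :
    reducedState (linkState lam) S T =
      attach (coreSub hP) (coreCutLeft hP.disjoint_right)
          (expandLeft fun z _ => (labelAmplitude lam z : ℂ)) *
        pinching (coreCutRight hP.disjoint_right) (pureState fun c => (labelAmplitude lam c : ℂ)) *
        (attach (coreSub hP) (coreCutLeft hP.disjoint_right)
          (expandLeft fun z _ => (labelAmplitude lam z : ℂ)))ᴴ := by
  rw [linkState, linkVector_eq_diagVec, reducedState_pureState_diagVec hP
    (g := fun h c => (labelAmplitude lam h : ℂ) * (labelAmplitude lam c : ℂ))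
    (v := fun z _ => (labelAmplitude lam z : ℂ)) fun c z h => ?_,
    ← Matrix.sum_mul, ← Matrix.mul_sum,
    sum_pinching_pureState_smul _ (sum_labelAmplitude_sq hlam_nonneg hlam_sum _)]
  rw [amplitude_glue]
  push_cast
  ring

theorem exists_linkState_filter (hST : Disjoint S T) (hlam_nonneg : ∀ e i, 0 ≤ lam e i)
    (hlam_sum : ∀ e, ∑ i, lam e i = 1) {ε : ℝ} (hε : 0 ≤ ε) :
    ∃ Q, IsGentleFilter (amplitude lam) (2 * ε) Q ∧ Q.FactorsThrough (subDiag Tᶜ) ∧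
      ∀ f₁ f₂ : EdgeLabels D → ℝ, (∀ x, |f₁ x| ≤ 1) → (∀ x, |f₂ x| ≤ 1) →
        f₁.FactorsThrough (subDiag Tᶜ) → f₂.FactorsThrough (subDiag T) →
        smoothCondMinEntropy ε (reducedState (linkState lam) S T) ≤
          condMinEntropy (reducedState
            (pureState (diagVec fun x => Q x * f₁ x * f₂ x * amplitude lam x)) S T) := by
  have hP := isTripartition_compl_union hST
  have hTR := hP.disjoint_right
  have hsq (p : G.edgeSet → Prop) [DecidablePred p] := sum_labelAmplitude_sq hlam_nonneg hlam_sum p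
  obtain ⟨Q, hQ, hentropy⟩ := exists_isGentleFilter_smoothCondMinEntropy_le
    (injective_coreSub_coreCutLeft hP) (injective_coreSub_coreCutRight hP)
    (conjTranspose_transpose_expand_id_mul (assemble_injective2 T)
      (v := fun z _ => (labelAmplitude lam z : ℂ)) fun _ => by simpa using hsq _)
    (amplitude_nonneg _) (hsq _) hε (InnerLabels D (S ∪ T)ᶜ)
  refine ⟨_, hQ.comp_glue_symm hlam_nonneg hlam_sum hTR, fun x x' h =>
    congrArg Q (factorsThrough_glue_symm_fst hTR h), fun f₁ f₂ hf₁ hf₂ h₁ h₂ => ?_⟩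
  obtain ⟨g₁, hg₁, hfg₁⟩ := exists_abs_le_one_factor (fun p => hf₁ (glue hTR p))
    fun p p' h => h₁ (factorsThrough_subDiag_compl_glue hTR h)
  obtain ⟨g₂, hg₂, hfg₂⟩ := exists_abs_le_one_factor (fun p => hf₂ (glue hTR p))
    fun p p' h => h₂ (factorsThrough_subDiag_glue_left hTR h)
  rw [reducedState_linkState hP hlam_nonneg hlam_sum, reducedState_pureState_diagVec hP
    (g := fun h c => ((g₁ (c, h) * labelAmplitude lam h : ℝ) : ℂ) *
      ((Q c * labelAmplitude lam c : ℝ) : ℂ))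
    (v := fun z k => ((g₂ (k, z) * labelAmplitude lam z : ℝ) : ℂ)) fun c z h => ?_]
  · refine hentropy _ _ (fun c => sum_norm_ofReal_mul_sq_le_one (fun h => hg₁ (c, h)) (hsq _))
      fun k => ?_
    simp only [expandLeft, transpose_apply, sum_norm_expand_id_sq (assemble_injective2 T)]
    exact sum_norm_ofReal_mul_sq_le_one (fun z => hg₂ (k, z)) (hsq _)
  · rw [hfg₁, hfg₂, amplitude_glue, Equiv.symm_apply_apply]
    push_cast
    ring

end GraphFilter

section Distance

variable {V : Type*} [Fintype V] [DecidableEq V] {G : SimpleGraph V} [DecidableRel G.Adj]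
  {D : G.edgeSet → ℕ} {lam : (e : G.edgeSet) → Fin (D e) → ℝ} {δ : ℝ} {f : EdgeLabels D → ℝ}

lemma pureState_diagVec_mul_amplitude_mem (hlam_nonneg : ∀ e i, 0 ≤ lam e i)
    (hlam_sum : ∀ e, ∑ i, lam e i = 1) (hf : ∀ x, |f x| ≤ 1) :
    pureState (diagVec fun x => f x * amplitude lam x) ∈ subnormalizedStates (Config D) := by
  refine pureState_mem_subnormalizedStates ?_
  simpa only [sum_norm_diagVec_sq, Complex.norm_real, Real.norm_eq_abs, sq_abs] using
    sum_norm_ofReal_mul_sq_le_one hf (sum_amplitude_sq hlam_nonneg hlam_sum)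

lemma purifiedDistance_linkState_le (hlam_nonneg : ∀ e i, 0 ≤ lam e i)
    (hlam_sum : ∀ e, ∑ i, lam e i = 1) (hf : IsGentleFilter (amplitude lam) δ f) :
    purifiedDistance (linkState lam) (pureState (diagVec fun x => f x * amplitude lam x)) ≤
      √(2 * δ) := by
  have hsq := sum_amplitude_sq hlam_nonneg hlam_sum
  rw [linkState, linkVector_eq_diagVec]
  refine purifiedDistance_pureState_le (by rw [sum_norm_diagVec_sq, hsq]) ?_
  simp only [star_diagVec_dotProduct, diagVec_diag, ← Complex.ofReal_mul, ← Complex.ofReal_sum,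
    Complex.norm_real]
  exact (hf.one_sub_le_sum_mul hsq).trans (Real.le_norm_self _)

end Distance

lemma sqrt_add_mul_le {m n ε : ℝ} (hm : 0 ≤ m) (hn : 0 ≤ n) (hε : 0 ≤ ε) :
    √(2 * (m * (2 * ε) + n * (2 * ε))) ≤ 2 * (√m + √n) * √ε := by
  rw [Real.sqrt_le_left (by positivity), mul_pow, mul_pow, add_sq, Real.sq_sqrt hm,
    Real.sq_sqrt hn, Real.sq_sqrt hε]
  nlinarith [mul_nonneg (mul_nonneg (Real.sqrt_nonneg m) (Real.sqrt_nonneg n)) hε]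

end

end LinkStates

theorem mainTheorem8_general {V : Type*} [Fintype V] [DecidableEq V] (G : SimpleGraph V)
    [DecidableRel G.Adj] (D : G.edgeSet → ℕ) (lam : (e : G.edgeSet) → Fin (D e) → ℝ)
    (hlam_nonneg : ∀ e i, 0 ≤ lam e i) (hlam_sum : ∀ e, ∑ i, lam e i = 1)
    (C₁ C₂ : Finset (Finset V)) (Γ : Finset V) (ε : ℝ) (hε : 0 ≤ ε) :
    ∃ ψ : Config D → ℂ,
      pureState ψ ∈ subnormalizedStates (Config D) ∧
      purifiedDistance (linkState lam) (pureState ψ) ≤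
        2 * (√(C₁.card : ℝ) + √(C₂.card : ℝ)) * √ε ∧
      (∀ Δ ∈ C₁, smoothCondMinEntropy ε (reducedState (linkState lam) (Γ \ Δ) Γᶜ) ≤
        condMinEntropy (reducedState (pureState ψ) (Γ \ Δ) Γᶜ)) ∧
      (∀ Δ ∈ C₂, smoothCondMinEntropy ε (reducedState (linkState lam) (Δ \ Γ) Γ) ≤
        condMinEntropy (reducedState (pureState ψ) (Δ \ Γ) Γ)) := by
  have hdisj (Δ : Finset V) : Disjoint (Γ \ Δ) Γᶜ := disjoint_compl_right.mono_left
    Finset.sdiff_subset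
  choose P hP hPΓ hPΔ using fun Δ => exists_linkState_filter (hdisj Δ) hlam_nonneg hlam_sum hε
  choose Q hQ hQΓ hQΔ using fun Δ =>
    exists_linkState_filter (Finset.sdiff_disjoint (s := Γ) (t := Δ)) hlam_nonneg hlam_sum hε
  rw [compl_compl] at hPΓ hPΔ
  have hPs := IsGentleFilter.finset_prod hP
  have hQs := IsGentleFilter.finset_prod hQ
  have hPsΓ := factorsThrough_finset_prod hPΓ
  have hQsΓ := factorsThrough_finset_prod hQΓ
  have hPQ := (hPs C₁).mul (hQs C₂)
  refine ⟨_, pureState_diagVec_mul_amplitude_mem hlam_nonneg hlam_sum hPQ.abs_le_one,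
    (purifiedDistance_linkState_le hlam_nonneg hlam_sum hPQ).trans
      (sqrt_add_mul_le C₁.card.cast_nonneg C₂.card.cast_nonneg hε), fun Δ hΔ => ?_, fun Δ hΔ => ?_⟩
  · simp only [← Finset.mul_prod_erase C₁ (P · _) hΔ]
    exact hPΔ Δ _ _ (hPs _).abs_le_one (hQs C₂).abs_le_one (hPsΓ _) (hQsΓ _)
  · simp only [mul_comm (∏ Δ ∈ C₁, P Δ _), ← Finset.mul_prod_erase C₂ (Q · _) hΔ]
    exact hQΔ Δ _ _ (hQs _).abs_le_one (hPs C₁).abs_le_one (hQsΓ _) (hPsΓ _)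

theorem mainTheorem8 {V : Type*} [Fintype V] [DecidableEq V] (G : SimpleGraph V)
    [DecidableRel G.Adj] (D : G.edgeSet → ℕ)
    (lam : (e : G.edgeSet) → Fin (D e) → ℝ)
    (hlam_nonneg : ∀ e i, 0 ≤ lam e i) (hlam_sum : ∀ e, ∑ i, lam e i = 1)
    (bdry A Γ : Finset V) (hA : A ⊆ bdry) (hΓ : Γ ∈ cuts bdry A)
    (ε : ℝ) (hε : 0 ≤ ε) :
    ∃ ψ : Config D → ℂ,
      pureState ψ ∈ subnormalizedStates (Config D) ∧
      purifiedDistance (linkState lam) (pureState ψ) ≤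
        2 * (√((smallerCuts bdry A Γ).card : ℝ) + √((largerCuts bdry A Γ).card : ℝ)) * √ε ∧
      (∀ Δ ∈ smallerCuts bdry A Γ,
        smoothCondMinEntropy ε (reducedState (linkState lam) (Γ \ Δ) Γᶜ) ≤
          condMinEntropy (reducedState (pureState ψ) (Γ \ Δ) Γᶜ)) ∧
      (∀ Δ ∈ largerCuts bdry A Γ,
        smoothCondMinEntropy ε (reducedState (linkState lam) (Δ \ Γ) Γ) ≤
          condMinEntropy (reducedState (pureState ψ) (Δ \ Γ) Γ)) := by
  exact mainTheorem8_general G D lam hlam_nonneg hlam_sum _ _ Γ ε hε
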